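/- Let $l\ge 3$. A cycle of length $l$ (an $l$-cycle) in a graph is identified with its set of $l$ edges. An $l$-cycle system of order $v$ is a partition of the edge set of the complete graph $K_v$ on $v$ vertices into $l$-cycles, called its blocks. Two $l$-cycle systems on the same $v$ vertices are orthogonal if every block of the first and every block of the second have at most one edge in common. Theorem. Let $3\le l\le 9$ and $v\ge l$, and suppose that $v$ is admissible for $l$, that is, that an $l$-cycle system of order $v$ exists. Then a pair of orthogonal $l$-cycle systems of order $v$ exists if and only if $(l,v)\notin\{(3,3),(5,5),(7,7),(9,9)\}$. In particular, for $l=5,6,7,8$ or $9$ a pair of orthogonal $l$-cycle systems of order $v$ exists for every admissible $v\geq l$, with the only exceptions $(l,v)=(5,5)$, $(7,7)$ and $(9,9)$; and for $l=3,4$ such a pair exists for every admissible $v\ge l$, with the only exception $(l,v)=(3,3)$. -/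

import Mathlib

/-- `B` is the edge set of a copy of the graph `H` in the graph `G`: a (not necessarily induced)
subgraph of `G` isomorphic to `H`. -/
def IsCopyEdgeSet {W V : Type*} (H : SimpleGraph W) (G : SimpleGraph V) (B : Set (Sym2 V)) : Prop :=
  ∃ f : SimpleGraph.Copy H G, f.toSubgraph.edgeSet = B

/-- `C` is an `H`-decomposition of `G` (for a graph `H` with at least one edge): a partition of the
edge set of `G` into blocks, each of which is the edge set of a copy of `H` in `G`. -/
structure IsGraphDecomposition {W V : Type*} (H : SimpleGraph W) (G : SimpleGraph V)
    (C : Set (Set (Sym2 V))) : Prop where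
  copy : ∀ B ∈ C, IsCopyEdgeSet H G B
  cover : ∀ e ∈ G.edgeSet, ∃! B, B ∈ C ∧ e ∈ B

/-- `C₁` and `C₂` are orthogonal: a block of `C₁` and a block of `C₂` share at most one edge. -/
def AreOrthogonal {V : Type*} (C₁ C₂ : Set (Set (Sym2 V))) : Prop :=
  ∀ B₁ ∈ C₁, ∀ B₂ ∈ C₂, (B₁ ∩ B₂).encard ≤ 1

/-- `C` is an `l`-cycle system of order `v`: a decomposition of the complete graph on `v` vertices
into cycles of length `l` (used for `3 ≤ l`). -/
def IsCycleSystem (l v : ℕ) (C : Set (Set (Sym2 (Fin v)))) : Prop :=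
  IsGraphDecomposition (SimpleGraph.cycleGraph l) (SimpleGraph.completeGraph (Fin v)) C

/-- There is a pair of orthogonal `l`-cycle systems of order `v`. -/
def ExistsOrthogonalPair (l v : ℕ) : Prop :=
  ∃ C₁ C₂ : Set (Set (Sym2 (Fin v))),
    IsCycleSystem l v C₁ ∧ IsCycleSystem l v C₂ ∧ AreOrthogonal C₁ C₂

/-! Necessity is a count: orthogonality forces the l edges of a block of one system into l different
blocks of the other, while a system of order v = l has only (l - 1)/2 blocks.

Sufficiency is a recursive construction. If a graph is an edge-disjoint union of graphs that each
carry an orthogonal pair, the pairs combine, because blocks in different pieces share no edge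
(`HasOrthogonalPair.iUnion`). The complete graph K_v is cut up along a linear space with a marked
point o and a marked block F through o: replace o by c vertices and every other point by w vertices.
A block of size b + 1 other than F then contributes K_{c+bw} with a hole on c vertices if it
contains o, and otherwise the complete multipartite graph with b + 1 parts of size w. The block F of
size f + 1 contributes the whole K_{c+fw}. This is `IsLinearSpace.hasOrthogonalPair`.

Counting edges and degrees shows that v = 2k + 1 with l dividing (2k + 1)k. As k and 2k + 1 are
coprime, only a few classes of k modulo l survive. For odd l, either l divides k or l divides 2k +
1, that is v = 1 + 2jl or v = l + 2jl. Take w = l, c = 1 or l, and a linear space on 2j + 1 points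
whose blocks are triples, except that F has 3 or 5 points. Such spaces come from the Bose and Skolem
constructions and a variant for 5 modulo 6 (`TripleSpace.existsTripleSpace`). For even l, take w =
2l and all pairs of points as blocks, with F = {o}, where c = 1, or c = 9 for one of the two classes
when l = 6. For each l only finitely many ingredient graphs remain, and explicit pairs for them are
verified by computation (`hasOrthogonalPair_of_pairCheck`). -/

/-! ### Transport and edge-disjoint unions of orthogonal pairs -/

/-- `G` has a pair of orthogonal `H`-decompositions. -/
def HasOrthogonalPair {W V : Type*} (H : SimpleGraph W) (G : SimpleGraph V) : Prop :=
  ∃ C₁ C₂ : Set (Set (Sym2 V)),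
    IsGraphDecomposition H G C₁ ∧ IsGraphDecomposition H G C₂ ∧ AreOrthogonal C₁ C₂

theorem isCopyEdgeSet_iff {W V : Type*} {H : SimpleGraph W} {G : SimpleGraph V}
    {B : Set (Sym2 V)} :
    IsCopyEdgeSet H G B ↔ ∃ f : W → V, Function.Injective f ∧
      (∀ a b, H.Adj a b → G.Adj (f a) (f b)) ∧ B = Sym2.map f '' H.edgeSet := by
  constructor
  · rintro ⟨f, rfl⟩
    refine ⟨f, f.injective, fun a b h => f.toHom.map_adj h, ?_⟩
    simp [SimpleGraph.Copy.toSubgraph, SimpleGraph.Subgraph.edgeSet_map]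
  · rintro ⟨f, hf, hadj, rfl⟩
    refine ⟨⟨⟨f, fun {a b} h => hadj a b h⟩, hf⟩, ?_⟩
    simp [SimpleGraph.Copy.toSubgraph, SimpleGraph.Subgraph.edgeSet_map]

theorem IsCopyEdgeSet.subset {W V : Type*} {H : SimpleGraph W} {G : SimpleGraph V}
    {B : Set (Sym2 V)} (h : IsCopyEdgeSet H G B) : B ⊆ G.edgeSet := by
  obtain ⟨f, rfl⟩ := h
  exact f.toSubgraph.edgeSet_subset

theorem IsCopyEdgeSet.mono {W V : Type*} {H : SimpleGraph W} {G G' : SimpleGraph V}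
    {B : Set (Sym2 V)} (h : IsCopyEdgeSet H G B) (hG : G ≤ G') : IsCopyEdgeSet H G' B := by
  rw [isCopyEdgeSet_iff] at h ⊢
  obtain ⟨f, hf, hadj, rfl⟩ := h
  exact ⟨f, hf, fun a b hab => hG (hadj a b hab), rfl⟩

theorem IsGraphDecomposition.map {W V V' : Type*} {H : SimpleGraph W} {G : SimpleGraph V}
    {C : Set (Set (Sym2 V))} (h : IsGraphDecomposition H G C) (φ : V ↪ V') :
    IsGraphDecomposition H (G.map φ) (Set.image (Sym2.map φ) '' C) := by
  have hφ : Function.Injective (Sym2.map φ) := Sym2.map.injective φ.injective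
  refine ⟨?_, ?_⟩
  · rintro _ ⟨B, hB, rfl⟩
    obtain ⟨f, hf, hadj, rfl⟩ := isCopyEdgeSet_iff.1 (h.copy B hB)
    refine isCopyEdgeSet_iff.2 ⟨φ ∘ f, φ.injective.comp hf, fun a b hab => ?_, ?_⟩
    · exact (SimpleGraph.map_adj_apply).2 (hadj a b hab)
    · rw [Set.image_image, Sym2.map_comp]; rfl
  · intro e he
    rw [SimpleGraph.edgeSet_map] at he
    obtain ⟨e, he, rfl⟩ := he
    obtain ⟨B, ⟨hB, heB⟩, huniq⟩ := h.cover e he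
    refine ⟨Sym2.map φ '' B, ⟨⟨B, hB, rfl⟩, e, heB, rfl⟩, ?_⟩
    rintro _ ⟨⟨B', hB', rfl⟩, heB'⟩
    rw [huniq B' ⟨hB', hφ.mem_set_image.1 heB'⟩]

theorem HasOrthogonalPair.map {W V V' : Type*} {H : SimpleGraph W} {G : SimpleGraph V}
    (h : HasOrthogonalPair H G) (φ : V ↪ V') : HasOrthogonalPair H (G.map φ) := by
  obtain ⟨C₁, C₂, h₁, h₂, h₁₂⟩ := h
  refine ⟨_, _, h₁.map φ, h₂.map φ, ?_⟩
  rintro _ ⟨B₁, hB₁, rfl⟩ _ ⟨B₂, hB₂, rfl⟩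
  have hφ : Function.Injective (Sym2.map φ) := Sym2.map.injective φ.injective
  rw [← Set.image_inter hφ, hφ.encard_image]
  exact h₁₂ B₁ hB₁ B₂ hB₂

/-- Transport along an injection identifying `G` with `G'` up to isolated vertices. -/
theorem HasOrthogonalPair.of_injective {W V V' : Type*} {H : SimpleGraph W} {G : SimpleGraph V}
    {G' : SimpleGraph V'} (h : HasOrthogonalPair H G) (φ : V → V') (hφ : Function.Injective φ)
    (hadj : ∀ a b, G'.Adj (φ a) (φ b) ↔ G.Adj a b)
    (hrange : ∀ x y, G'.Adj x y → x ∈ Set.range φ) : HasOrthogonalPair H G' := by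
  have : G' = G.map (⟨φ, hφ⟩ : V ↪ V') := by
    ext x y
    rw [SimpleGraph.map_adj]
    constructor
    · intro hxy
      obtain ⟨a, rfl⟩ := hrange x y hxy
      obtain ⟨b, rfl⟩ := hrange y _ hxy.symm
      exact ⟨a, b, (hadj a b).1 hxy, rfl, rfl⟩
    · rintro ⟨a, b, hab, rfl, rfl⟩
      exact (hadj a b).2 hab
  rw [this]
  exact h.map _

theorem HasOrthogonalPair.of_iso {W V V' : Type*} {H : SimpleGraph W} {G : SimpleGraph V}
    {G' : SimpleGraph V'} (h : HasOrthogonalPair H G) (φ : G ≃g G') : HasOrthogonalPair H G' :=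
  h.of_injective φ φ.injective (fun _ _ => φ.map_adj_iff) fun x _ _ => φ.surjective x

theorem IsGraphDecomposition.iUnion {W V ι : Type*} {H : SimpleGraph W} {G : SimpleGraph V}
    {K : ι → SimpleGraph V} {C : ι → Set (Set (Sym2 V))}
    (h : ∀ i, IsGraphDecomposition H (K i) (C i)) (hle : ∀ i, K i ≤ G)
    (huniq : ∀ e ∈ G.edgeSet, ∃! i, e ∈ (K i).edgeSet) :
    IsGraphDecomposition H G (⋃ i, C i) := by
  refine ⟨?_, ?_⟩
  · intro B hB
    obtain ⟨i, hi⟩ := Set.mem_iUnion.1 hB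
    exact ((h i).copy B hi).mono (hle i)
  · intro e he
    obtain ⟨i, hi, hi'⟩ := huniq e he
    obtain ⟨B, ⟨hB, heB⟩, hB'⟩ := (h i).cover e hi
    refine ⟨B, ⟨Set.mem_iUnion.2 ⟨i, hB⟩, heB⟩, ?_⟩
    rintro B' ⟨hB'', heB'⟩
    obtain ⟨j, hj⟩ := Set.mem_iUnion.1 hB''
    obtain rfl := hi' j (((h j).copy B' hj).subset heB')
    exact hB' B' ⟨hj, heB'⟩

/-- Orthogonal pairs of edge-disjoint graphs combine to an orthogonal pair of their union. -/
theorem HasOrthogonalPair.iUnion {W V ι : Type*} {H : SimpleGraph W} {G : SimpleGraph V}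
    (K : ι → SimpleGraph V) (h : ∀ i, HasOrthogonalPair H (K i)) (hle : ∀ i, K i ≤ G)
    (huniq : ∀ x y, G.Adj x y → ∃! i, (K i).Adj x y) : HasOrthogonalPair H G := by
  choose C₁ C₂ h₁ h₂ h₁₂ using h
  have huniq' : ∀ e ∈ G.edgeSet, ∃! i, e ∈ (K i).edgeSet := by
    intro e
    induction e with | _ x y => exact huniq x y
  refine ⟨_, _, .iUnion h₁ hle huniq', .iUnion h₂ hle huniq', ?_⟩
  intro B₁ hB₁ B₂ hB₂
  obtain ⟨i, hi⟩ := Set.mem_iUnion.1 hB₁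
  obtain ⟨j, hj⟩ := Set.mem_iUnion.1 hB₂
  rw [Set.encard_le_one_iff]
  rintro e e' ⟨he₁, he₂⟩ he'
  have hei := ((h₁ i).copy B₁ hi).subset he₁
  have hej := ((h₂ j).copy B₂ hj).subset he₂
  -- A common edge lies in only one piece, so the two blocks belong to the same piece and its own
  -- orthogonality applies.
  obtain rfl := (huniq' e (SimpleGraph.edgeSet_mono (hle i) hei)).unique hei hej
  exact Set.encard_le_one_iff.1 (h₁₂ i B₁ hi B₂ hj) e e' ⟨he₁, he₂⟩ he'

theorem hasOrthogonalPair_bot {W V : Type*} (H : SimpleGraph W) :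
    HasOrthogonalPair H (⊥ : SimpleGraph V) :=
  ⟨∅, ∅, ⟨by simp, by simp⟩, ⟨by simp, by simp⟩, by simp [AreOrthogonal]⟩

/-! ### Bit-mask certificates for orthogonal pairs -/

/-- Rotates by `k` places inside each of the consecutive intervals with lengths `os`. -/
def intervalShift : List ℕ → ℕ → ℕ → ℕ
  | [], _, x => x
  | o :: os, k, x => bif x.blt o then (x + k) % o else o + intervalShift os k (x - o)

/-- The cycles obtained from base cycles: `(r, c)` stands for the first `r` shifts of `c`. -/
def develop (os : List ℕ) (S : List (ℕ × List ℕ)) : List (List ℕ) :=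
  S.flatMap fun p => (List.range p.1).map fun k => p.2.map (intervalShift os k)

/-- A number for the unordered pair of two numbers below `n`. -/
def pairCode (n a b : ℕ) : ℕ := bif a.blt b then a * n + b else b * n + a

def cycleCodes (n : ℕ) (c : List ℕ) : List ℕ := List.zipWith (pairCode n) c (c.rotate 1)

def bitMask (s : List ℕ) : ℕ := s.foldr (fun k m => 2 ^ k ||| m) 0

def cycleMask (n : ℕ) (c : List ℕ) : ℕ := bitMask (cycleCodes n c)

/-- The edges of the graph on `{0, …, n - 1}` with adjacency `adj a b` for `a < b`, as a mask. -/
def graphMask (n : ℕ) (adj : ℕ → ℕ → Bool) : ℕ :=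
  bitMask ((List.range n).flatMap fun b =>
    ((List.range b).filter fun a => adj a b).map fun a => a * n + b)

def disjointUnionCheck (M : ℕ) : ℕ → List ℕ → Bool
  | acc, [] => acc == M
  | acc, m :: ms => (acc &&& m == 0) && disjointUnionCheck M (acc ||| m) ms

def systemCheck (n l M : ℕ) (S : List (List ℕ)) : Bool :=
  (S.all fun c => c.length == l && c.all (· < n) && decide c.Nodup) &&
    disjointUnionCheck M 0 (S.map (cycleMask n))

/-- `x &&& (x - 1)` clears the lowest set bit. By truncated subtraction `x = 0` passes too, as it
should for disjoint blocks. -/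
def atMostOneBit (x : ℕ) : Bool := x &&& (x - 1) == 0

def orthogonalCheck (ms₁ ms₂ : List ℕ) : Bool :=
  ms₁.all fun m₁ => ms₂.all fun m₂ => atMostOneBit (m₁ &&& m₂)

def pairCheck (n l : ℕ) (adj : ℕ → ℕ → Bool) (S₁ S₂ : List (List ℕ)) : Bool :=
  systemCheck n l (graphMask n adj) S₁ && systemCheck n l (graphMask n adj) S₂ &&
    orthogonalCheck (S₁.map (cycleMask n)) (S₂.map (cycleMask n))

theorem testBit_bitMask (s : List ℕ) (k : ℕ) : (bitMask s).testBit k = true ↔ k ∈ s := by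
  induction s with
  | nil => simp [bitMask]
  | cons a s ih =>
    have : bitMask (a :: s) = 2 ^ a ||| bitMask s := rfl
    rw [this, Nat.testBit_or, Bool.or_eq_true, ih, Nat.testBit_two_pow, List.mem_cons,
      decide_eq_true_eq, eq_comm]

/-- The code is n · min + max with max < n, so both endpoints are recovered by division with
remainder. -/
theorem pairCode_eq_iff {n a b x y : ℕ} (ha : a < n) (hb : b < n) (hx : x < n) (hy : y < n) :
    pairCode n a b = pairCode n x y ↔ a = x ∧ b = y ∨ a = y ∧ b = x := by
  have key : ∀ {p q r s : ℕ}, q < n → s < n → (p * n + q = r * n + s ↔ p = r ∧ q = s) := by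
    intro p q r s hq hs
    constructor
    · intro h
      have hn : 0 < n := by omega
      have h₁ := congrArg (· / n) h
      have h₂ := congrArg (· % n) h
      simp only [Nat.mul_comm _ n, Nat.mul_add_div hn, Nat.div_eq_of_lt hq, Nat.div_eq_of_lt hs,
        Nat.mul_add_mod, Nat.mod_eq_of_lt hq, Nat.mod_eq_of_lt hs] at h₁ h₂
      exact ⟨h₁, h₂⟩
    · rintro ⟨rfl, rfl⟩; rfl
  unfold pairCode
  cases h₁ : a.blt b <;> cases h₂ : x.blt y <;>
    simp only [cond_true, cond_false, key, ha, hb, hx, hy] <;>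
    simp only [← Bool.not_eq_true, Nat.blt_eq] at h₁ h₂ <;> omega

theorem mem_cycleCodes {n k : ℕ} {w : List ℕ} :
    k ∈ cycleCodes n w ↔ ∃ (i : ℕ) (hi : i < w.length),
      pairCode n w[i] (w[(i + 1) % w.length]'(Nat.mod_lt _ (by omega))) = k := by
  unfold cycleCodes
  rw [List.mem_iff_getElem]
  constructor
  · rintro ⟨i, hi, rfl⟩
    have hi' : i < w.length := by simpa using hi
    exact ⟨i, hi', by simp [List.getElem_rotate]⟩
  · rintro ⟨i, hi, rfl⟩
    exact ⟨i, by simpa using hi, by simp [List.getElem_rotate]⟩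

theorem mem_graphMask {n : ℕ} {adj : ℕ → ℕ → Bool} {G : SimpleGraph (Fin n)}
    (hG : ∀ x y : Fin n, x < y → (G.Adj x y ↔ adj x y = true)) {x y : Fin n} :
    (graphMask n adj).testBit (pairCode n x y) = true ↔ G.Adj x y := by
  have key : ∀ {x y : Fin n}, (∃ a b : ℕ, a < b ∧ b < n ∧ adj a b = true ∧
      pairCode n a b = pairCode n x y) ↔ G.Adj x y := by
    intro x y
    constructor
    · rintro ⟨a, b, hab, hb, h, hc⟩
      have h' := (hG ⟨a, hab.trans hb⟩ ⟨b, hb⟩ hab).2 h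
      rcases (pairCode_eq_iff (hab.trans hb) hb x.2 y.2).1 hc with ⟨rfl, rfl⟩ | ⟨rfl, rfl⟩
      exacts [h', h'.symm]
    · intro h
      rcases lt_or_gt_of_ne h.ne with hxy | hxy
      · exact ⟨x, y, hxy, y.2, (hG x y hxy).1 h, rfl⟩
      · exact ⟨y, x, hxy, x.2, (hG y x hxy).1 h.symm,
          (pairCode_eq_iff y.2 x.2 x.2 y.2).2 (Or.inr ⟨rfl, rfl⟩)⟩
  rw [← key, graphMask, testBit_bitMask]
  simp only [List.mem_flatMap, List.mem_map, List.mem_filter, List.mem_range]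
  constructor
  · rintro ⟨b, hb, a, ⟨hab, h⟩, he⟩
    exact ⟨a, b, hab, hb, h, by rw [← he, pairCode, show a.blt b = true by simpa using hab]; rfl⟩
  · rintro ⟨a, b, hab, hb, h, he⟩
    exact ⟨b, hb, a, ⟨hab, h⟩, by rw [← he, pairCode, show a.blt b = true by simpa using hab]; rfl⟩

/-- Here `acc` is the union of the masks already read. That it misses every later mask is the part
of the induction hypothesis that gives disjointness from the current one. -/
theorem disjointUnionCheck_spec {M : ℕ} : ∀ {acc : ℕ} {ms : List ℕ},
    disjointUnionCheck M acc ms = true → ∀ k, (M.testBit k = true ↔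
      acc.testBit k = true ∨ ∃ m ∈ ms, m.testBit k = true) ∧
      (∀ m ∈ ms, m.testBit k = true → acc.testBit k = false ∧
        ∀ m' ∈ ms, m'.testBit k = true → m' = m) := by
  intro acc ms
  induction ms generalizing acc with
  | nil => intro h k; simp [disjointUnionCheck] at h; simp [h]
  | cons m ms ih =>
    intro h k
    simp only [disjointUnionCheck, Bool.and_eq_true, beq_iff_eq] at h
    obtain ⟨h₁, h₂⟩ := ih h.2 k
    have h₀ : (acc.testBit k && m.testBit k) = false := by
      rw [← Nat.testBit_and, h.1, Nat.zero_testBit]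
    simp only [Nat.testBit_or, Bool.or_eq_true] at h₁ h₂
    refine ⟨by simp [h₁, or_assoc], ?_⟩
    intro m' hm' hk
    rcases List.mem_cons.1 hm' with rfl | hm'
    · refine ⟨by simpa [hk] using h₀, ?_⟩
      intro m'' hm'' hk''
      rcases List.mem_cons.1 hm'' with rfl | hm''
      · rfl
      · have := (h₂ m'' hm'' hk'').1
        simp [hk] at this
    · have h₃ := h₂ m' hm' hk
      have h₄ := h₃.1
      rw [Bool.or_eq_false_iff] at h₄
      refine ⟨h₄.1, ?_⟩
      intro m'' hm'' hk''
      rcases List.mem_cons.1 hm'' with rfl | hm''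
      · simp [hk''] at h₄
      · exact h₃.2 m'' hm'' hk''

theorem atMostOneBit_spec {x i j : ℕ} (h : atMostOneBit x = true) (hi : x.testBit i = true)
    (hj : x.testBit j = true) : i = j := by
  have hx : x ≠ 0 := by rintro rfl; simp at hi
  simp only [atMostOneBit, beq_iff_eq] at h
  obtain ⟨k, rfl⟩ := (Nat.and_sub_one_eq_zero_iff_isPowerOfTwo hx).1 h
  rw [Nat.testBit_two_pow, decide_eq_true_eq] at hi hj
  omega

/-- The block on `Fin n` described by a mask. -/
def maskBlock (n m : ℕ) : Set (Sym2 (Fin n)) :=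
  {e | ∃ x y : Fin n, e = s(x, y) ∧ m.testBit (pairCode n x y) = true}

theorem mk_mem_maskBlock {n m : ℕ} {x y : Fin n} :
    s(x, y) ∈ maskBlock n m ↔ m.testBit (pairCode n x y) = true := by
  constructor
  · rintro ⟨a, b, hab, h⟩
    rw [← h]
    congr 1
    rw [pairCode_eq_iff x.2 y.2 a.2 b.2]
    rw [Sym2.eq_iff] at hab
    simpa [Fin.ext_iff] using hab
  · intro h
    exact ⟨x, y, rfl, h⟩

theorem isCopyEdgeSet_maskBlock {n l : ℕ} (hl : 3 ≤ l) {G : SimpleGraph (Fin n)} {w : List ℕ}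
    (hc : w.length = l) (hn : ∀ x ∈ w, x < n) (hd : w.Nodup)
    (hG : maskBlock n (cycleMask n w) ⊆ G.edgeSet) :
    IsCopyEdgeSet (SimpleGraph.cycleGraph l) G (maskBlock n (cycleMask n w)) := by
  -- In `Fin (l + 2)` addition wraps around, so the closing edge of the cycle is again of the form
  -- {i, i + 1}.
  obtain ⟨l, rfl⟩ : ∃ k, l = k + 2 := ⟨l - 2, by omega⟩
  let f : Fin (l + 2) → Fin n := fun i => ⟨w[i.1]'(by rw [hc]; exact i.2), hn _ (List.getElem_mem _)⟩
  have hf : Function.Injective f := by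
    intro i j hij
    have := Fin.val_eq_of_eq hij
    exact Fin.ext ((hd.getElem_inj_iff).1 this)
  have hB : ∀ x y : Fin n, s(x, y) ∈ maskBlock n (cycleMask n w) ↔
      ∃ i : Fin (l + 2), s(f i, f (i + 1)) = s(x, y) := by
    intro x y
    rw [mk_mem_maskBlock, cycleMask, testBit_bitMask, mem_cycleCodes]
    constructor
    · rintro ⟨i, hi, h⟩
      refine ⟨⟨i, by rw [← hc]; exact hi⟩, ?_⟩
      rw [pairCode_eq_iff (hn _ (List.getElem_mem _)) (hn _ (List.getElem_mem _)) x.2 y.2] at h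
      simpa [Sym2.eq_iff, Fin.ext_iff, f, Fin.val_add, hc] using h
    · rintro ⟨i, h⟩
      refine ⟨i.1, by rw [hc]; exact i.2, ?_⟩
      rw [pairCode_eq_iff (hn _ (List.getElem_mem _)) (hn _ (List.getElem_mem _)) x.2 y.2]
      simpa [Sym2.eq_iff, Fin.ext_iff, f, Fin.val_add, hc] using h
  have hstep : ∀ i : Fin (l + 2), s(f i, f (i + 1)) ∈ maskBlock n (cycleMask n w) :=
    fun i => (hB _ _).2 ⟨i, rfl⟩
  refine isCopyEdgeSet_iff.2 ⟨f, hf, ?_, ?_⟩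
  · intro a b hab
    rw [SimpleGraph.cycleGraph_adj] at hab
    rcases hab with h | h
    · obtain rfl : a = b + 1 := by rw [← h]; abel
      exact (G.mem_edgeSet.1 (hG (hstep b))).symm
    · obtain rfl : b = a + 1 := by rw [← h]; abel
      exact G.mem_edgeSet.1 (hG (hstep a))
  · ext e
    induction e with | _ x y =>
    rw [hB]
    constructor
    · rintro ⟨i, hi⟩
      refine ⟨s(i, i + 1), ?_, by simpa using hi⟩
      rw [SimpleGraph.mem_edgeSet, SimpleGraph.cycleGraph_adj]
      right; abel
    · rintro ⟨e, he, hxy⟩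
      induction e with | _ a b =>
      rw [SimpleGraph.mem_edgeSet, SimpleGraph.cycleGraph_adj] at he
      rw [Sym2.map_mk] at hxy
      rcases he with h | h
      · obtain rfl : a = b + 1 := by rw [← h]; abel
        exact ⟨b, by rw [← hxy, Sym2.eq_swap]⟩
      · obtain rfl : b = a + 1 := by rw [← h]; abel
        exact ⟨a, hxy⟩

theorem isGraphDecomposition_of_systemCheck {n l : ℕ} (hl : 3 ≤ l) {G : SimpleGraph (Fin n)}
    {adj : ℕ → ℕ → Bool} (hG : ∀ x y : Fin n, x < y → (G.Adj x y ↔ adj x y = true))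
    {S : List (List ℕ)} (h : systemCheck n l (graphMask n adj) S = true) :
    IsGraphDecomposition (SimpleGraph.cycleGraph l) G
      {B | ∃ m ∈ S.map (cycleMask n), maskBlock n m = B} := by
  simp only [systemCheck, Bool.and_eq_true, List.all_eq_true, beq_iff_eq, decide_eq_true_eq] at h
  obtain ⟨hS, hU⟩ := h
  have hU' := disjointUnionCheck_spec hU
  refine ⟨?_, ?_⟩
  · rintro _ ⟨m, hm, rfl⟩
    obtain ⟨c, hc, rfl⟩ := List.mem_map.1 hm
    obtain ⟨⟨hlen, hn⟩, hd⟩ := hS c hc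
    refine isCopyEdgeSet_maskBlock hl hlen hn hd ?_
    intro e he
    induction e with | _ x y =>
    rw [mk_mem_maskBlock] at he
    rw [SimpleGraph.mem_edgeSet, ← mem_graphMask hG, (hU' _).1]
    exact Or.inr ⟨_, hm, he⟩
  · intro e he
    induction e with | _ x y =>
    rw [SimpleGraph.mem_edgeSet, ← mem_graphMask hG, (hU' _).1] at he
    rcases he with he | ⟨m, hm, he⟩
    · simp at he
    · refine ⟨maskBlock n m, ⟨⟨m, hm, rfl⟩, mk_mem_maskBlock.2 he⟩, ?_⟩
      rintro _ ⟨⟨m', hm', rfl⟩, he'⟩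
      rw [((hU' _).2 m hm he).2 m' hm' (mk_mem_maskBlock.1 he')]

theorem hasOrthogonalPair_of_pairCheck {n l : ℕ} (hl : 3 ≤ l) {G : SimpleGraph (Fin n)}
    {adj : ℕ → ℕ → Bool} (hG : ∀ x y : Fin n, x < y → (G.Adj x y ↔ adj x y = true))
    {S₁ S₂ : List (List ℕ)} (h : pairCheck n l adj S₁ S₂ = true) :
    HasOrthogonalPair (SimpleGraph.cycleGraph l) G := by
  simp only [pairCheck, Bool.and_eq_true, orthogonalCheck, List.all_eq_true] at h
  obtain ⟨⟨h₁, h₂⟩, h₁₂⟩ := h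
  refine ⟨_, _, isGraphDecomposition_of_systemCheck hl hG h₁,
    isGraphDecomposition_of_systemCheck hl hG h₂, ?_⟩
  rintro _ ⟨m₁, hm₁, rfl⟩ _ ⟨m₂, hm₂, rfl⟩
  rw [Set.encard_le_one_iff]
  rintro e e' ⟨he₁, he₂⟩ ⟨he₁', he₂'⟩
  induction e with | _ x y =>
  induction e' with | _ x' y' =>
  rw [mk_mem_maskBlock] at he₁ he₂ he₁' he₂'
  have := atMostOneBit_spec (h₁₂ m₁ hm₁ m₂ hm₂) (i := pairCode n x y) (j := pairCode n x' y')
    (by rw [Nat.testBit_and, he₁, he₂]; rfl) (by rw [Nat.testBit_and, he₁', he₂']; rfl)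
  rw [pairCode_eq_iff x.2 y.2 x'.2 y'.2] at this
  simpa [Sym2.eq_iff, Fin.ext_iff] using this

/-! ### Ingredient graphs and their explicit orthogonal pairs -/

/-- The complete graph on `Fin n` without the edges between the first `c` vertices. -/
def holeyGraph (c n : ℕ) : SimpleGraph (Fin n) where
  Adj x y := x ≠ y ∧ ¬(x.1 < c ∧ y.1 < c)
  symm := ⟨fun _ _ h => ⟨h.1.symm, fun h' => h.2 h'.symm⟩⟩
  loopless := ⟨fun _ h => h.1 rfl⟩

/-- The complete multipartite graph on `Fin n` whose parts are the residue classes modulo `t`. -/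
def residueGraph (t n : ℕ) : SimpleGraph (Fin n) where
  Adj x y := x.1 % t ≠ y.1 % t
  symm := ⟨fun _ _ h => h.symm⟩
  loopless := ⟨fun _ h => h rfl⟩

/-- The test is only made for a < b, where the pair avoids the hole exactly when the larger vertex b
does. -/
theorem hasOrthogonalPair_holeyGraph {c n l : ℕ} (hl : 3 ≤ l) (os : List ℕ)
    (S₁ S₂ : List (ℕ × List ℕ))
    (h : pairCheck n l (fun _ b => !b.blt c) (develop os S₁) (develop os S₂) = true) :
    HasOrthogonalPair (SimpleGraph.cycleGraph l) (holeyGraph c n) := by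
  refine hasOrthogonalPair_of_pairCheck hl (fun x y hxy => ?_) h
  have : x.1 < y.1 := hxy
  rw [Bool.not_eq_true', ← Bool.not_eq_true, Nat.blt_eq]
  simp only [holeyGraph]
  omega

theorem hasOrthogonalPair_residueGraph {t n l : ℕ} (hl : 3 ≤ l) (os : List ℕ)
    (S₁ S₂ : List (ℕ × List ℕ))
    (h : pairCheck n l (fun a b => !(a % t).beq (b % t)) (develop os S₁) (develop os S₂) = true) :
    HasOrthogonalPair (SimpleGraph.cycleGraph l) (residueGraph t n) := by
  refine hasOrthogonalPair_of_pairCheck hl (fun x y hxy => ?_) h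
  rw [Bool.not_eq_true', ← Bool.not_eq_true, Nat.beq_eq]
  rfl

theorem hasOrthogonalPair_cycle3_holeyGraph_1_7 :
    HasOrthogonalPair (SimpleGraph.cycleGraph 3) (holeyGraph 1 7) :=
  hasOrthogonalPair_holeyGraph (by norm_num) [7]
    [(7, [1, 4, 3])]
    [(7, [0, 2, 6])]
    (by decide +kernel)

theorem hasOrthogonalPair_cycle3_holeyGraph_1_13 :
    HasOrthogonalPair (SimpleGraph.cycleGraph 3) (holeyGraph 1 13) :=
  hasOrthogonalPair_holeyGraph (by norm_num) [13]
    [(13, [0, 10, 1]), (13, [3, 1, 9])]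
    [(13, [0, 5, 11]), (13, [3, 12, 0])]
    (by decide +kernel)

theorem hasOrthogonalPair_cycle3_holeyGraph_1_9 :
    HasOrthogonalPair (SimpleGraph.cycleGraph 3) (holeyGraph 1 9) :=
  hasOrthogonalPair_holeyGraph (by norm_num) [3, 3, 3]
    [(3, [1, 2, 7]), (3, [1, 8, 5]), (3, [1, 3, 4]), (3, [4, 8, 6])]
    [(3, [0, 7, 6]), (3, [8, 0, 5]), (3, [8, 4, 3]), (3, [3, 0, 2])]
    (by decide +kernel)

theorem hasOrthogonalPair_cycle3_holeyGraph_1_15 :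
    HasOrthogonalPair (SimpleGraph.cycleGraph 3) (holeyGraph 1 15) :=
  hasOrthogonalPair_holeyGraph (by norm_num) [1, 7, 7]
    [(7, [0, 10, 1]), (7, [1, 5, 6]), (7, [2, 10, 8]), (7, [5, 8, 12]), (7, [1, 13, 12])]
    [(7, [0, 13, 5]), (7, [1, 10, 3]), (7, [7, 1, 12]), (7, [1, 5, 11]), (7, [8, 14, 12])]
    (by decide +kernel)

theorem hasOrthogonalPair_cycle3_holeyGraph_3_9 :
    HasOrthogonalPair (SimpleGraph.cycleGraph 3) (holeyGraph 3 9) :=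
  hasOrthogonalPair_holeyGraph (by norm_num) [1, 1, 1, 2, 2, 2]
    [(1, [1, 6, 5]), (2, [1, 3, 8]), (2, [4, 6, 8]), (2, [4, 5, 2]), (1, [3, 4, 0]),
     (2, [5, 8, 0]), (1, [2, 8, 7])]
    [(2, [0, 4, 8]), (1, [0, 5, 6]), (2, [4, 5, 1]), (1, [1, 8, 7]), (2, [6, 4, 7]),
     (1, [3, 4, 2]), (2, [5, 7, 2])]
    (by decide +kernel)

theorem hasOrthogonalPair_cycle3_residueGraph_3_9 :
    HasOrthogonalPair (SimpleGraph.cycleGraph 3) (residueGraph 3 9) :=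
  hasOrthogonalPair_residueGraph (by norm_num) [9]
    [(1, [3, 2, 7]), (1, [6, 5, 1]), (1, [0, 8, 4]), (1, [4, 2, 6]), (1, [7, 5, 0]),
     (1, [1, 8, 3]), (1, [1, 0, 2]), (1, [4, 3, 5]), (1, [7, 6, 8])]
    [(1, [3, 4, 2]), (1, [6, 7, 5]), (1, [0, 1, 8]), (1, [6, 4, 8]), (1, [0, 7, 2]),
     (1, [3, 1, 5]), (1, [0, 5, 4]), (1, [3, 8, 7]), (1, [6, 2, 1])]
    (by decide +kernel)

/-- Both base cycles of the first system are invariant under translation by 8, so 8 shifts of each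
exhaust their orbits. -/
theorem hasOrthogonalPair_cycle4_residueGraph_2_16 :
    HasOrthogonalPair (SimpleGraph.cycleGraph 4) (residueGraph 2 16) :=
  hasOrthogonalPair_residueGraph (by norm_num) [16]
    [(8, [1, 2, 9, 10]), (8, [5, 10, 13, 2])]
    [(16, [0, 9, 4, 3])]
    (by decide +kernel)

theorem hasOrthogonalPair_cycle4_holeyGraph_1_9 :
    HasOrthogonalPair (SimpleGraph.cycleGraph 4) (holeyGraph 1 9) :=
  hasOrthogonalPair_holeyGraph (by norm_num) [9]
    [(9, [1, 2, 6, 4])]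
    [(9, [1, 2, 8, 6])]
    (by decide +kernel)

theorem hasOrthogonalPair_cycle5_holeyGraph_1_11 :
    HasOrthogonalPair (SimpleGraph.cycleGraph 5) (holeyGraph 1 11) :=
  hasOrthogonalPair_holeyGraph (by norm_num) [11]
    [(11, [0, 10, 5, 7, 3])]
    [(11, [1, 10, 2, 3, 7])]
    (by decide +kernel)

theorem hasOrthogonalPair_cycle5_holeyGraph_1_21 :
    HasOrthogonalPair (SimpleGraph.cycleGraph 5) (holeyGraph 1 21) :=
  hasOrthogonalPair_holeyGraph (by norm_num) [21]
    [(21, [0, 10, 11, 16, 4]), (21, [0, 7, 13, 11, 3])]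
    [(21, [0, 8, 3, 1, 4]), (21, [1, 10, 11, 0, 7])]
    (by decide +kernel)

theorem hasOrthogonalPair_cycle5_holeyGraph_1_15 :
    HasOrthogonalPair (SimpleGraph.cycleGraph 5) (holeyGraph 1 15) :=
  hasOrthogonalPair_holeyGraph (by norm_num) [1, 7, 7]
    [(7, [0, 10, 12, 11, 1]), (7, [12, 9, 3, 4, 7]), (7, [10, 1, 9, 5, 3])]
    [(7, [0, 12, 10, 1, 4]), (7, [1, 12, 7, 6, 9]), (7, [6, 4, 10, 9, 13])]
    (by decide +kernel)

theorem hasOrthogonalPair_cycle5_holeyGraph_1_25 :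
    HasOrthogonalPair (SimpleGraph.cycleGraph 5) (holeyGraph 1 25) :=
  hasOrthogonalPair_holeyGraph (by norm_num) [5, 5, 5, 5, 5]
    [(5, [0, 10, 21, 24, 8]), (5, [21, 22, 13, 10, 2]), (5, [22, 12, 0, 5, 18]),
     (5, [20, 13, 14, 5, 19]), (5, [10, 23, 5, 1, 18]), (5, [12, 9, 2, 17, 19]),
     (5, [12, 7, 17, 24, 3]), (5, [13, 19, 24, 5, 17]), (5, [11, 16, 2, 8, 9]),
     (5, [12, 6, 21, 4, 1]), (5, [24, 7, 9, 15, 16]), (5, [18, 0, 23, 3, 2])]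
    [(5, [0, 17, 16, 23, 15]), (5, [18, 15, 4, 10, 14]), (5, [16, 11, 18, 4, 20]),
     (5, [16, 13, 1, 20, 10]), (5, [15, 2, 3, 21, 9]), (5, [18, 24, 9, 23, 5]),
     (5, [16, 21, 20, 12, 9]), (5, [19, 9, 3, 8, 5]), (5, [22, 20, 14, 8, 0]),
     (5, [24, 4, 2, 6, 10]), (5, [21, 5, 9, 11, 14]), (5, [9, 2, 11, 1, 14])]
    (by decide +kernel)

theorem hasOrthogonalPair_cycle5_holeyGraph_5_15 :
    HasOrthogonalPair (SimpleGraph.cycleGraph 5) (holeyGraph 5 15) :=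
  hasOrthogonalPair_holeyGraph (by norm_num) [5, 5, 5]
    [(5, [0, 14, 7, 13, 9]), (5, [0, 13, 1, 12, 7]), (5, [3, 13, 5, 0, 6]),
     (1, [14, 11, 13, 10, 12]), (1, [12, 13, 14, 10, 11]), (1, [5, 8, 6, 9, 7]),
     (1, [6, 5, 9, 8, 7])]
    [(1, [0, 12, 9, 10, 13]), (1, [1, 8, 5, 12, 6]), (1, [3, 7, 13, 8, 14]),
     (1, [2, 11, 6, 7, 9]), (1, [4, 10, 14, 11, 5]), (1, [0, 10, 1, 11, 9]),
     (1, [1, 12, 3, 10, 5]), (1, [3, 8, 2, 12, 13]), (1, [2, 7, 4, 8, 6]), (1, [4, 11, 0, 7, 14]),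
     (1, [2, 10, 6, 0, 14]), (1, [4, 12, 14, 1, 9]), (1, [0, 8, 9, 3, 5]), (1, [1, 7, 5, 2, 13]),
     (1, [3, 11, 13, 4, 6]), (1, [12, 7, 10, 8, 11]), (1, [11, 10, 12, 8, 7]),
     (1, [6, 5, 14, 13, 9]), (1, [14, 6, 13, 5, 9])]
    (by decide +kernel)

theorem hasOrthogonalPair_cycle5_residueGraph_3_15 :
    HasOrthogonalPair (SimpleGraph.cycleGraph 5) (residueGraph 3 15) :=
  hasOrthogonalPair_residueGraph (by norm_num) [15]
    [(15, [0, 14, 7, 9, 5])]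
    [(15, [0, 4, 9, 1, 14])]
    (by decide +kernel)

theorem hasOrthogonalPair_cycle6_residueGraph_2_24 :
    HasOrthogonalPair (SimpleGraph.cycleGraph 6) (residueGraph 2 24) :=
  hasOrthogonalPair_residueGraph (by norm_num) [24]
    [(24, [0, 19, 2, 1, 22, 9])]
    [(24, [0, 21, 10, 15, 6, 23])]
    (by decide +kernel)

theorem hasOrthogonalPair_cycle6_holeyGraph_1_13 :
    HasOrthogonalPair (SimpleGraph.cycleGraph 6) (holeyGraph 1 13) :=
  hasOrthogonalPair_holeyGraph (by norm_num) [13]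
    [(13, [0, 10, 12, 3, 9, 1])]
    [(13, [0, 1, 6, 12, 2, 11])]
    (by decide +kernel)

theorem hasOrthogonalPair_cycle6_holeyGraph_9_21 :
    HasOrthogonalPair (SimpleGraph.cycleGraph 6) (holeyGraph 9 21) :=
  hasOrthogonalPair_holeyGraph (by norm_num) [3, 3, 3, 3, 3, 3, 3]
    [(1, [0, 18, 1, 19, 2, 20]), (3, [0, 19, 13, 2, 16, 10]), (3, [2, 11, 4, 13, 10, 15]),
     (3, [0, 11, 8, 20, 19, 15]), (3, [0, 13, 15, 4, 16, 12]), (3, [3, 16, 19, 6, 20, 11]),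
     (1, [5, 18, 4, 20, 3, 19]), (3, [4, 19, 11, 9, 13, 14]), (3, [4, 10, 8, 17, 7, 12]),
     (3, [6, 10, 20, 15, 11, 13]), (3, [7, 15, 17, 14, 18, 13])]
    [(3, [2, 15, 4, 10, 6, 18]), (3, [4, 16, 13, 10, 12, 19]), (3, [3, 19, 17, 7, 15, 11]),
     (3, [4, 17, 15, 19, 2, 14]), (3, [4, 18, 9, 19, 8, 11]), (3, [3, 14, 1, 15, 6, 12]),
     (3, [7, 20, 18, 10, 15, 14]), (3, [6, 11, 9, 15, 0, 14]), (3, [16, 19, 1, 11, 12, 14]),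
     (1, [1, 10, 2, 11, 0, 9]), (1, [12, 20, 14, 19, 13, 18])]
    (by decide +kernel)

theorem hasOrthogonalPair_cycle6_holeyGraph_1_9 :
    HasOrthogonalPair (SimpleGraph.cycleGraph 6) (holeyGraph 1 9) :=
  hasOrthogonalPair_holeyGraph (by norm_num) [3, 3, 3]
    [(3, [0, 2, 6, 4, 7, 8]), (3, [6, 0, 4, 1, 3, 5])]
    [(3, [3, 7, 6, 2, 8, 5]), (3, [8, 3, 2, 4, 1, 0])]
    (by decide +kernel)

theorem hasOrthogonalPair_cycle7_holeyGraph_1_15 :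
    HasOrthogonalPair (SimpleGraph.cycleGraph 7) (holeyGraph 1 15) :=
  hasOrthogonalPair_holeyGraph (by norm_num) [15]
    [(15, [0, 10, 4, 6, 3, 7, 8])]
    [(15, [1, 5, 3, 13, 4, 7, 8])]
    (by decide +kernel)

theorem hasOrthogonalPair_cycle7_holeyGraph_1_29 :
    HasOrthogonalPair (SimpleGraph.cycleGraph 7) (holeyGraph 1 29) :=
  hasOrthogonalPair_holeyGraph (by norm_num) [29]
    [(29, [0, 10, 19, 21, 15, 3, 25]), (29, [0, 26, 12, 25, 17, 6, 1])]
    [(29, [0, 4, 3, 21, 2, 15, 27]), (29, [0, 23, 1, 21, 6, 27, 3])]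
    (by decide +kernel)

theorem hasOrthogonalPair_cycle7_holeyGraph_1_21 :
    HasOrthogonalPair (SimpleGraph.cycleGraph 7) (holeyGraph 1 21) :=
  hasOrthogonalPair_holeyGraph (by norm_num) [5, 5, 5, 5, 1]
    [(5, [0, 10, 16, 19, 6, 9, 4]), (5, [1, 18, 17, 3, 11, 8, 19]),
     (5, [16, 1, 9, 3, 14, 18, 11]), (5, [18, 2, 0, 12, 5, 10, 20]),
     (5, [2, 11, 13, 14, 17, 5, 6]), (5, [12, 6, 4, 20, 7, 17, 8])]
    [(5, [0, 5, 8, 9, 3, 18, 19]), (5, [7, 18, 5, 14, 1, 4, 0]), (5, [5, 1, 18, 15, 8, 14, 12]),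
     (5, [9, 1, 11, 15, 2, 13, 20]), (5, [6, 15, 10, 3, 19, 9, 14]),
     (5, [0, 14, 13, 19, 11, 18, 20])]
    (by decide +kernel)

theorem hasOrthogonalPair_cycle7_holeyGraph_1_35 :
    HasOrthogonalPair (SimpleGraph.cycleGraph 7) (holeyGraph 1 35) :=
  hasOrthogonalPair_holeyGraph (by norm_num) [1, 17, 17]
    [(17, [0, 10, 1, 32, 7, 17, 24]), (17, [4, 16, 10, 23, 24, 26, 32]),
     (17, [2, 1, 21, 12, 31, 28, 6]), (17, [9, 11, 34, 7, 22, 30, 26]),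
     (17, [2, 5, 34, 27, 32, 14, 18])]
    [(17, [0, 14, 1, 15, 33, 4, 26]), (17, [7, 2, 12, 33, 32, 26, 15]),
     (17, [2, 3, 30, 20, 32, 24, 8]), (17, [2, 17, 26, 29, 5, 19, 32]),
     (17, [2, 27, 10, 33, 1, 20, 22])]
    (by decide +kernel)

theorem hasOrthogonalPair_cycle7_holeyGraph_7_21 :
    HasOrthogonalPair (SimpleGraph.cycleGraph 7) (holeyGraph 7 21) :=
  hasOrthogonalPair_holeyGraph (by norm_num) [7, 7, 7]
    [(7, [1, 12, 5, 8, 18, 4, 17]), (7, [0, 17, 5, 16, 8, 14, 12]), (7, [6, 14, 9, 0, 8, 19, 12]),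
     (1, [11, 7, 10, 13, 9, 12, 8]), (1, [9, 8, 7, 13, 12, 11, 10]),
     (1, [7, 9, 11, 13, 8, 10, 12]), (1, [16, 18, 20, 15, 17, 19, 14]),
     (1, [20, 14, 15, 16, 17, 18, 19]), (1, [17, 20, 16, 19, 15, 18, 14])]
    [(1, [2, 11, 5, 12, 13, 0, 9]), (1, [6, 17, 4, 20, 15, 5, 13]), (1, [3, 7, 1, 19, 18, 4, 15]),
     (1, [0, 12, 2, 14, 10, 1, 18]), (1, [5, 20, 6, 11, 8, 2, 10]), (1, [4, 19, 3, 17, 16, 6, 8]),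
     (1, [1, 14, 0, 7, 9, 3, 16]), (1, [1, 9, 5, 16, 12, 10, 11]), (1, [2, 13, 4, 9, 20, 8, 17]),
     (1, [6, 15, 1, 13, 19, 16, 7]), (1, [3, 18, 2, 15, 14, 9, 12]),
     (1, [0, 10, 6, 18, 11, 13, 20]), (1, [5, 8, 3, 10, 17, 15, 19]),
     (1, [4, 16, 0, 8, 7, 18, 14]), (1, [4, 10, 20, 1, 12, 15, 11]),
     (1, [1, 8, 19, 2, 20, 18, 17]), (1, [2, 16, 14, 6, 19, 10, 7]),
     (1, [6, 9, 11, 3, 14, 8, 12]), (1, [3, 13, 17, 0, 11, 16, 20]),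
     (1, [0, 15, 7, 5, 17, 9, 19]), (1, [5, 18, 12, 4, 7, 13, 14]),
     (1, [14, 7, 19, 17, 20, 11, 12]), (1, [20, 12, 7, 17, 11, 14, 19]),
     (1, [7, 20, 14, 17, 12, 19, 11]), (1, [16, 13, 18, 8, 9, 15, 10]),
     (1, [18, 10, 8, 16, 9, 13, 15]), (1, [9, 18, 16, 15, 8, 13, 10])]
    (by decide +kernel)

theorem hasOrthogonalPair_cycle7_residueGraph_3_21 :
    HasOrthogonalPair (SimpleGraph.cycleGraph 7) (residueGraph 3 21) :=
  hasOrthogonalPair_residueGraph (by norm_num) [21]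
    [(21, [0, 14, 12, 7, 18, 17, 13])]
    [(21, [0, 13, 20, 18, 8, 4, 5])]
    (by decide +kernel)

theorem hasOrthogonalPair_cycle8_residueGraph_2_32 :
    HasOrthogonalPair (SimpleGraph.cycleGraph 8) (residueGraph 2 32) :=
  hasOrthogonalPair_residueGraph (by norm_num) [32]
    [(8, [0, 19, 24, 11, 16, 3, 8, 27]), (16, [0, 11, 8, 7, 16, 27, 24, 23]),
     (8, [5, 20, 13, 28, 21, 4, 29, 12])]
    [(32, [0, 15, 16, 11, 2, 27, 24, 13])]
    (by decide +kernel)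

theorem hasOrthogonalPair_cycle8_holeyGraph_1_17 :
    HasOrthogonalPair (SimpleGraph.cycleGraph 8) (holeyGraph 1 17) :=
  hasOrthogonalPair_holeyGraph (by norm_num) [17]
    [(17, [0, 10, 6, 9, 14, 5, 4, 15])]
    [(17, [0, 9, 10, 15, 8, 12, 14, 3])]
    (by decide +kernel)

theorem hasOrthogonalPair_cycle9_holeyGraph_1_19 :
    HasOrthogonalPair (SimpleGraph.cycleGraph 9) (holeyGraph 1 19) :=
  hasOrthogonalPair_holeyGraph (by norm_num) [19]
    [(19, [0, 10, 15, 12, 5, 7, 3, 2, 13])]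
    [(19, [2, 12, 1, 4, 9, 10, 6, 13, 0])]
    (by decide +kernel)

theorem hasOrthogonalPair_cycle9_holeyGraph_1_37 :
    HasOrthogonalPair (SimpleGraph.cycleGraph 9) (holeyGraph 1 37) :=
  hasOrthogonalPair_holeyGraph (by norm_num) [37]
    [(37, [0, 10, 3, 29, 8, 11, 28, 13, 36]), (37, [1, 10, 6, 18, 16, 29, 23, 15, 33])]
    [(37, [0, 14, 13, 17, 22, 24, 2, 26, 16]), (37, [0, 7, 36, 8, 19, 13, 10, 35, 18])]
    (by decide +kernel)

theorem hasOrthogonalPair_cycle9_holeyGraph_1_27 :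
    HasOrthogonalPair (SimpleGraph.cycleGraph 9) (holeyGraph 1 27) :=
  hasOrthogonalPair_holeyGraph (by norm_num) [1, 13, 13]
    [(13, [0, 10, 4, 26, 19, 8, 24, 3, 18]), (13, [1, 19, 22, 24, 16, 4, 8, 11, 15]),
     (13, [19, 20, 10, 11, 3, 1, 14, 18, 12])]
    [(13, [0, 4, 12, 16, 20, 6, 15, 5, 24]), (13, [2, 6, 18, 16, 23, 15, 8, 1, 13]),
     (13, [10, 7, 22, 25, 12, 20, 9, 14, 26])]
    (by decide +kernel)

theorem hasOrthogonalPair_cycle9_holeyGraph_1_45 :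
    HasOrthogonalPair (SimpleGraph.cycleGraph 9) (holeyGraph 1 45) :=
  hasOrthogonalPair_holeyGraph (by norm_num) [1, 11, 11, 11, 11]
    [(11, [0, 10, 16, 13, 37, 20, 40, 19, 41]), (11, [0, 19, 32, 2, 10, 3, 9, 12, 30]),
     (11, [12, 22, 37, 24, 44, 2, 1, 34, 41]), (11, [13, 17, 27, 28, 36, 35, 30, 25, 22]),
     (11, [17, 22, 6, 40, 43, 37, 5, 42, 28]), (11, [12, 42, 3, 39, 1, 28, 35, 11, 24]),
     (11, [37, 35, 23, 32, 6, 36, 20, 24, 27]), (11, [36, 22, 28, 6, 27, 23, 38, 15, 7]),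
     (11, [34, 28, 8, 12, 1, 22, 30, 14, 23]), (11, [13, 11, 23, 9, 26, 8, 10, 19, 1])]
    [(11, [0, 3, 43, 2, 20, 24, 19, 12, 26]), (11, [0, 12, 14, 26, 4, 6, 23, 32, 40]),
     (11, [12, 13, 35, 44, 30, 7, 38, 18, 29]), (11, [14, 17, 24, 40, 7, 44, 33, 37, 20]),
     (11, [12, 33, 20, 28, 27, 44, 38, 25, 11]), (11, [23, 26, 7, 2, 5, 25, 16, 35, 8]),
     (11, [23, 27, 3, 7, 42, 16, 40, 33, 43]), (11, [31, 25, 4, 14, 1, 21, 42, 17, 2]),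
     (11, [32, 5, 16, 43, 9, 34, 2, 41, 44]), (11, [1, 18, 36, 37, 44, 21, 5, 19, 11])]
    (by decide +kernel)

theorem hasOrthogonalPair_cycle9_holeyGraph_9_27 :
    HasOrthogonalPair (SimpleGraph.cycleGraph 9) (holeyGraph 9 27) :=
  hasOrthogonalPair_holeyGraph (by norm_num) [9, 9, 9]
    [(9, [0, 18, 8, 14, 13, 19, 7, 22, 23]), (9, [0, 26, 10, 1, 15, 17, 20, 9, 22]),
     (3, [2, 22, 17, 5, 25, 11, 8, 19, 14]), (3, [4, 20, 12, 1, 26, 9, 7, 23, 15]),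
     (9, [4, 11, 7, 15, 25, 23, 26, 17, 14]), (1, [11, 15, 10, 14, 9, 13, 17, 12, 16]),
     (1, [20, 25, 21, 26, 22, 18, 23, 19, 24])]
    [(9, [1, 10, 0, 18, 9, 26, 22, 6, 20]), (9, [0, 21, 1, 23, 12, 26, 11, 8, 15]),
     (3, [2, 26, 10, 5, 20, 13, 8, 23, 16]), (3, [4, 21, 11, 7, 24, 14, 1, 18, 17]),
     (9, [0, 11, 14, 18, 21, 22, 24, 12, 17]), (1, [15, 17, 10, 12, 14, 16, 9, 11, 13]),
     (1, [15, 14, 13, 12, 11, 10, 9, 17, 16])]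
    (by decide +kernel)

theorem hasOrthogonalPair_cycle9_residueGraph_3_27 :
    HasOrthogonalPair (SimpleGraph.cycleGraph 9) (residueGraph 3 27) :=
  hasOrthogonalPair_residueGraph (by norm_num) [27]
    [(27, [0, 14, 15, 19, 17, 7, 12, 4, 11])]
    [(9, [0, 1, 26, 18, 19, 17, 9, 10, 8]), (9, [4, 8, 18, 13, 17, 0, 22, 26, 9]),
     (9, [3, 17, 10, 21, 8, 1, 12, 26, 19])]
    (by decide +kernel)

/-! ### Linear spaces and their blow-ups -/

/-- A linear space on `P`: any two points lie on a unique block. The block `F` passes through the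
point `o`, and the other blocks have `b` points. -/
structure IsLinearSpace {P : Type*} (o : P) (F : Finset P) (b : ℕ) (𝓑 : Set (Finset P)) : Prop where
  mem : F ∈ 𝓑
  base_mem : o ∈ F
  card : ∀ B ∈ 𝓑, B ≠ F → B.card = b
  pair : ∀ x y, x ≠ y → ∃! B, B ∈ 𝓑 ∧ x ∈ B ∧ y ∈ B

/-- The blow-up of a point set: `c` copies of `o` and `w` copies of each other point. -/
abbrev BlowUp {P : Type*} (o : P) (c w : ℕ) : Type _ := Fin c ⊕ ({p : P // p ≠ o} × Fin w)

namespace BlowUp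

variable {P : Type*} {o : P} {c w : ℕ}

/-- The point below a vertex of the blow-up. -/
def point : BlowUp o c w → P
  | .inl _ => o
  | .inr q => q.1

theorem point_inr_ne (q : {p : P // p ≠ o} × Fin w) :
    point (.inr q : BlowUp o c w) ≠ o := q.1.2

/-- The part of the complete graph on the blow-up that belongs to the block `B`. -/
def blockGraph (o : P) (c w : ℕ) (F B : Finset P) : SimpleGraph (BlowUp o c w) where
  Adj u v := u ≠ v ∧ point u ∈ B ∧ point v ∈ B ∧
    (o ∈ B → B ≠ F → ¬(point u = o ∧ point v = o)) ∧ (o ∉ B → point u ≠ point v)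
  symm := ⟨fun _ _ h => ⟨h.1.symm, h.2.2.1, h.2.1, fun h₁ h₂ h₃ => h.2.2.2.1 h₁ h₂ h₃.symm,
    fun h₁ => (h.2.2.2.2 h₁).symm⟩⟩
  loopless := ⟨fun _ h => h.1 rfl⟩

theorem exists_enumeration {S : Finset P} (ho : o ∉ S) {t : ℕ} (ht : S.card = t) :
    ∃ e : Fin t → {p : P // p ≠ o}, Function.Injective e ∧ ∀ q, q.1 ∈ S ↔ q ∈ Set.range e := by
  let f := (S.equivFinOfCardEq ht).symm
  refine ⟨fun i => ⟨(f i).1, fun h => ho (h ▸ (f i).2)⟩, ?_, ?_⟩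
  · intro i j hij
    have h := congrArg (fun q => q.1) hij
    exact f.injective (Subtype.ext h)
  · intro q
    constructor
    · intro hq
      exact ⟨f.symm ⟨q.1, hq⟩, by simp⟩
    · rintro ⟨i, rfl⟩
      exact (f i).2

/-- The blow-up of a block through `o`. -/
def embedThrough {t : ℕ} (e : Fin t → {p : P // p ≠ o}) (x : Fin (c + t * w)) : BlowUp o c w :=
  Sum.map id (fun y => Prod.map e id (finProdFinEquiv.symm y)) (finSumFinEquiv.symm x)

theorem embedThrough_injective {t : ℕ} {e : Fin t → {p : P // p ≠ o}}
    (he : Function.Injective e) :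
    Function.Injective (embedThrough e : Fin (c + t * w) → BlowUp o c w) :=
  (Function.Injective.sumMap Function.injective_id
    ((he.prodMap Function.injective_id).comp (Equiv.injective _))).comp (Equiv.injective _)

theorem mem_range_embedThrough {t : ℕ} {e : Fin t → {p : P // p ≠ o}} {B : Finset P}
    (hr : ∀ q : {p : P // p ≠ o}, q.1 ∈ B ↔ q ∈ Set.range e) (u : BlowUp o c w)
    (hu : point u ∈ B) :
    u ∈ Set.range (embedThrough e : Fin (c + t * w) → BlowUp o c w) := by
  rcases u with i | ⟨q, a⟩
  · exact ⟨finSumFinEquiv (.inl i), by simp [embedThrough]⟩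
  · obtain ⟨j, rfl⟩ := (hr q).1 hu
    exact ⟨finSumFinEquiv (.inr (finProdFinEquiv (j, a))), by
      simp only [embedThrough, Equiv.symm_apply_apply, Sum.map_inr, Prod.map_apply, id]⟩

theorem point_embedThrough_eq {t : ℕ} (e : Fin t → {p : P // p ≠ o}) (x : Fin (c + t * w)) :
    point (embedThrough e x : BlowUp o c w) = o ↔ x.1 < c := by
  obtain ⟨y, rfl⟩ := finSumFinEquiv.surjective x
  rcases y with i | i
  · simp [embedThrough, point]
  · simpa [embedThrough] using point_inr_ne (c := c) (Prod.map e id (finProdFinEquiv.symm i))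

theorem point_embedThrough_mem {t : ℕ} {e : Fin t → {p : P // p ≠ o}} {B : Finset P} (ho : o ∈ B)
    (hr : ∀ q : {p : P // p ≠ o}, q.1 ∈ B ↔ q ∈ Set.range e) (x : Fin (c + t * w)) :
    point (embedThrough e x : BlowUp o c w) ∈ B := by
  obtain ⟨y, rfl⟩ := finSumFinEquiv.surjective x
  rcases y with i | i
  · simpa [embedThrough, point] using ho
  · simp only [embedThrough, Equiv.symm_apply_apply]
    exact (hr _).2 ⟨_, rfl⟩

/-- The hole size `h` is kept separate from `c` so that one statement serves F, where `h = 1` means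
no hole at all, and the other blocks through o, where `h = c`. The first c vertices of the model are
the copies of o. -/
theorem hasOrthogonalPair_blockGraph_through {W : Type*} {H : SimpleGraph W} {F B : Finset P}
    (ho : o ∈ B) {t h : ℕ} (ht : B.card = t + 1)
    (hh : ∀ x y : Fin (c + t * w), x ≠ y →
      (¬(x.1 < h ∧ y.1 < h) ↔ B = F ∨ ¬(x.1 < c ∧ y.1 < c)))
    (hp : HasOrthogonalPair H (holeyGraph h (c + t * w))) :
    HasOrthogonalPair H (blockGraph o c w F B) := by
  classical
  obtain ⟨e, he, hr'⟩ := exists_enumeration (S := B.erase o) (Finset.notMem_erase o B) (t := t)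
    (by rw [Finset.card_erase_of_mem ho, ht]; rfl)
  have hr : ∀ q : {p : P // p ≠ o}, q.1 ∈ B ↔ q ∈ Set.range e := by
    intro q; rw [← hr', Finset.mem_erase]; simp [q.2]
  refine hp.of_injective (embedThrough e) (embedThrough_injective he) ?_
    fun u _ h => mem_range_embedThrough hr u h.2.1
  intro x y
  simp only [blockGraph, holeyGraph, (embedThrough_injective he).ne_iff, point_embedThrough_mem ho hr,
    ho, point_embedThrough_eq, true_and, not_true_eq_false, false_imp_iff, and_true, true_imp_iff]
  refine and_congr_right fun hxy => ?_
  rw [hh x y hxy, or_iff_not_imp_left]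

theorem hasOrthogonalPair_blockGraph_off {W : Type*} {H : SimpleGraph W} {F B : Finset P}
    (ho : o ∉ B) {b : ℕ} (hb : B.card = b) (hp : HasOrthogonalPair H (residueGraph b (w * b))) :
    HasOrthogonalPair H (blockGraph o c w F B) := by
  obtain ⟨e, he, hr⟩ := exists_enumeration ho hb
  -- `finProdFinEquiv` sends (a, j) to a * b + j: the residue modulo b selects the point of the
  -- block, the quotient selects its copy.
  have hinj : Function.Injective fun x : Fin (w * b) =>
      (.inr ((e (finProdFinEquiv.symm x).2, (finProdFinEquiv.symm x).1)) : BlowUp o c w) := by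
    intro x y hxy
    simp only [Sum.inr.injEq, Prod.mk.injEq, he.eq_iff] at hxy
    exact finProdFinEquiv.symm.injective (Prod.ext hxy.2 hxy.1)
  refine hp.of_injective _ hinj ?_ ?_
  · intro x y
    have hmem : ∀ x : Fin (w * b), (e (finProdFinEquiv.symm x).2).1 ∈ B :=
      fun x => (hr _).2 ⟨_, rfl⟩
    have hne : (e (finProdFinEquiv.symm x).2).1 ≠ (e (finProdFinEquiv.symm y).2).1 ↔
        x.1 % b ≠ y.1 % b := by
      rw [Subtype.coe_injective.ne_iff, he.ne_iff, Ne, Fin.ext_iff]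
      rfl
    simp only [blockGraph, residueGraph, hinj.ne_iff, point, hmem, ho, true_and, hne,
      not_false_eq_true, true_imp_iff, false_imp_iff]
    refine and_iff_right_of_imp fun h h' => h (h' ▸ rfl)
  · rintro (i | ⟨q, a⟩) v h
    · exact absurd h.2.1 ho
    · obtain ⟨j, rfl⟩ := (hr q).1 h.2.1
      exact ⟨finProdFinEquiv (a, j), by simp⟩

end BlowUp

open BlowUp in
/-- Orthogonal pairs for the blow-ups of the blocks of a linear space give an orthogonal pair for
the blow-up of the space. -/
theorem IsLinearSpace.hasOrthogonalPair {W P : Type*} {H : SimpleGraph W} {o : P} {F : Finset P}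
    {b c w f : ℕ} {𝓑 : Set (Finset P)} (h : IsLinearSpace o F (b + 1) 𝓑) (hf : F.card = f + 1)
    (hfull : HasOrthogonalPair H (holeyGraph 1 (c + f * w)))
    (hhole : HasOrthogonalPair H (holeyGraph c (c + b * w)))
    (hpart : HasOrthogonalPair H (residueGraph (b + 1) (w * (b + 1)))) :
    HasOrthogonalPair H (⊤ : SimpleGraph (BlowUp o c w)) := by
  refine HasOrthogonalPair.iUnion (ι := 𝓑) (fun B => blockGraph o c w F B.1) ?_ (fun _ => le_top) ?_
  · rintro ⟨B, hB⟩
    by_cases hBF : B = F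
    · subst hBF
      refine hasOrthogonalPair_blockGraph_through h.base_mem hf (fun x y hxy => ?_) hfull
      simp only [true_or, iff_true]
      rintro ⟨h₁, h₂⟩
      exact hxy (Fin.ext (by omega))
    · have hcard := h.card B hB hBF
      by_cases ho : o ∈ B
      · exact hasOrthogonalPair_blockGraph_through ho hcard (fun x y _ => by simp [hBF]) hhole
      · exact hasOrthogonalPair_blockGraph_off ho hcard hpart
  · intro u v huv
    have huv' : u ≠ v := huv
    have hinter : ∀ B ∈ 𝓑, ∀ B' ∈ 𝓑, ∀ x y, x ≠ y → x ∈ B → y ∈ B → x ∈ B' → y ∈ B' → B = B' :=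
      fun B hB B' hB' x y hxy h₁ h₂ h₃ h₄ =>
        (h.pair x y hxy).unique ⟨hB, h₁, h₂⟩ ⟨hB', h₃, h₄⟩
    by_cases hp : point u = point v
    · by_cases hpo : point u = o
      · refine ⟨⟨F, h.mem⟩, ?_, ?_⟩
        · have hu : point u ∈ F := hpo.symm ▸ h.base_mem
          exact ⟨huv', hu, hp ▸ hu, fun _ h' => absurd rfl h',
            fun h' => absurd h.base_mem h'⟩
        · rintro ⟨B, hB⟩ hadj
          refine Subtype.ext ?_
          by_contra hBF
          exact hadj.2.2.2.1 (hpo ▸ hadj.2.1) hBF ⟨hpo, hp ▸ hpo⟩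
      -- An edge between two copies of p ≠ o is assigned to the block through p and o.
      · obtain ⟨B, ⟨hB, hu, ho⟩, -⟩ := h.pair (point u) o hpo
        refine ⟨⟨B, hB⟩, ?_, ?_⟩
        · exact ⟨huv', hu, hp ▸ hu, fun _ _ h' => hpo h'.1, fun h' => absurd ho h'⟩
        · rintro ⟨B', hB'⟩ hadj
          have ho' : o ∈ B' := by
            by_contra h'
            exact hadj.2.2.2.2 h' hp
          exact Subtype.ext (hinter _ hB' _ hB _ _ hpo hadj.2.1 ho' hu ho)
    -- An edge over two distinct points is assigned to the block joining them.
    · obtain ⟨B, ⟨hB, hu, hv⟩, -⟩ := h.pair _ _ hp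
      refine ⟨⟨B, hB⟩, ?_, ?_⟩
      · exact ⟨huv', hu, hv, fun _ _ h' => hp (h'.1.trans h'.2.symm), fun _ => hp⟩
      · rintro ⟨B', hB'⟩ hadj
        exact Subtype.ext (hinter _ hB' _ hB _ _ hp hadj.2.1 hadj.2.2.1 hu hv)

theorem card_blowUp {P : Type*} [Fintype P] [DecidableEq P] (o : P) (c w : ℕ) :
    Fintype.card (BlowUp o c w) = c + (Fintype.card P - 1) * w := by
  rw [Fintype.card_sum, Fintype.card_prod, Fintype.card_fin, Fintype.card_fin,
    Fintype.card_subtype_compl, Fintype.card_subtype_eq]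

theorem existsOrthogonalPair_iff {l v : ℕ} : ExistsOrthogonalPair l v ↔
    HasOrthogonalPair (SimpleGraph.cycleGraph l) (⊤ : SimpleGraph (Fin v)) := Iff.rfl

theorem IsLinearSpace.existsOrthogonalPair {P : Type*} [Fintype P] {l : ℕ} {o : P}
    {F : Finset P} {b c w f v : ℕ} {𝓑 : Set (Finset P)} (h : IsLinearSpace o F (b + 1) 𝓑)
    (hf : F.card = f + 1) (hv : v = c + (Fintype.card P - 1) * w)
    (hfull : HasOrthogonalPair (SimpleGraph.cycleGraph l) (holeyGraph 1 (c + f * w)))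
    (hhole : HasOrthogonalPair (SimpleGraph.cycleGraph l) (holeyGraph c (c + b * w)))
    (hpart : HasOrthogonalPair (SimpleGraph.cycleGraph l) (residueGraph (b + 1) (w * (b + 1)))) :
    ExistsOrthogonalPair l v := by
  classical
  have e : BlowUp o c w ≃ Fin v := Fintype.equivFinOfCardEq (by rw [card_blowUp, hv])
  exact existsOrthogonalPair_iff.2
    ((h.hasOrthogonalPair hf hfull hhole hpart).of_iso (SimpleGraph.Iso.completeGraph e))

/-- All pairs of points, and a singleton. -/
theorem isLinearSpace_pairs (k : ℕ) :
    IsLinearSpace (none : Option (Fin k)) {none} 2 ({B | B.card = 2} ∪ {{none}}) where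
  mem := Or.inr rfl
  base_mem := by simp
  card := by
    rintro B (hB | hB) hF
    exacts [hB, absurd hB hF]
  pair := by
    intro x y hxy
    refine ⟨{x, y}, ⟨Or.inl (Finset.card_pair hxy), by simp, by simp⟩, ?_⟩
    rintro B ⟨hB | hB, hx, hy⟩
    · refine (Finset.eq_of_subset_of_card_le ?_ ?_).symm
      · intro z hz
        rcases Finset.mem_insert.1 hz with rfl | hz
        exacts [hx, Finset.mem_singleton.1 hz ▸ hy]
      · rw [Finset.card_pair hxy]; exact hB.le
    · rw [Set.mem_singleton_iff.1 hB, Finset.mem_singleton] at hx hy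
      exact absurd (hx.trans hy.symm) hxy

/-! ### Linear spaces from Steiner operations -/

/-- A partial Steiner quasigroup, undefined on the pairs from `F`, gives a linear space. -/
theorem IsLinearSpace.of_op {P : Type*} [DecidableEq P] {o : P} {F : Finset P} (ho : o ∈ F)
    (m : P → P → P) (hcomm : ∀ x y, m x y = m y x)
    (hm : ∀ x y, x ≠ y → ¬(x ∈ F ∧ y ∈ F) →
      m x y ≠ x ∧ ¬(x ∈ F ∧ m x y ∈ F) ∧ m x (m x y) = y) :
    IsLinearSpace o F 3
      ({F} ∪ {B | ∃ x y, x ≠ y ∧ ¬(x ∈ F ∧ y ∈ F) ∧ B = {x, y, m x y}}) := by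
  have hm' : ∀ x y, x ≠ y → ¬(x ∈ F ∧ y ∈ F) →
      m x y ≠ y ∧ ¬(y ∈ F ∧ m x y ∈ F) ∧ m y (m x y) = x := by
    intro x y hxy hF
    rw [hcomm x y]
    exact hm y x hxy.symm fun h => hF h.symm
  -- Any two points of a triple generate the same triple, and never both lie in F; this is the
  -- uniqueness of the block through two points.
  have key : ∀ x y, x ≠ y → ¬(x ∈ F ∧ y ∈ F) → ∀ p ∈ ({x, y, m x y} : Finset P),
      ∀ q ∈ ({x, y, m x y} : Finset P), p ≠ q →
        ¬(p ∈ F ∧ q ∈ F) ∧ ({x, y, m x y} : Finset P) = {p, q, m p q} := by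
    intro x y hxy hF p hp q hq hpq
    obtain ⟨h₁, h₂, h₃⟩ := hm x y hxy hF
    obtain ⟨h₄, h₅, h₆⟩ := hm' x y hxy hF
    have h₇ := hcomm y x
    have h₈ := hcomm x (m x y)
    have h₉ := hcomm y (m x y)
    rw [h₃] at h₈
    rw [h₆] at h₉
    generalize hz : m x y = z at *
    simp only [Finset.mem_insert, Finset.mem_singleton] at hp hq
    rcases hp with hp | hp | hp <;> rcases hq with hq | hq | hq <;> rw [hp, hq] at hpq ⊢ <;>
      first
      | exact absurd rfl hpq
      | refine ⟨by tauto, ?_⟩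
        first | rw [hz] | rw [h₃] | rw [h₆] | rw [h₇] | rw [← h₈] | rw [← h₉]
        try
          clear * -
          ext t
          simp only [Finset.mem_insert, Finset.mem_singleton]
          tauto
  refine ⟨Or.inl rfl, ho, ?_, ?_⟩
  · rintro B (hB | ⟨x, y, hxy, hF, rfl⟩) hBF
    · exact absurd hB hBF
    · exact Finset.card_eq_three.2 ⟨x, y, m x y, hxy, (hm x y hxy hF).1.symm,
        (hm' x y hxy hF).1.symm, rfl⟩
  · intro x y hxy
    by_cases hF : x ∈ F ∧ y ∈ F
    · refine ⟨F, ⟨Or.inl rfl, hF⟩, ?_⟩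
      rintro B ⟨hB | ⟨x', y', hxy', hF', rfl⟩, hx, hy⟩
      · exact hB
      · exact absurd hF (key x' y' hxy' hF' x hx y hy hxy).1
    · refine ⟨{x, y, m x y}, ⟨Or.inr ⟨x, y, hxy, hF, rfl⟩, by simp, by simp⟩, ?_⟩
      rintro B ⟨hB | ⟨x', y', hxy', hF', rfl⟩, hx, hy⟩
      · rw [Set.mem_singleton_iff.1 hB] at hx hy
        exact absurd ⟨hx, hy⟩ hF
      · exact (key x' y' hxy' hF' x hx y hy hxy).2

/-- There is a linear space on `n` points with a block of `s` points, the others having three. -/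
def ExistsTripleSpace (n s : ℕ) : Prop :=
  ∃ (P : Type) (_ : Fintype P) (o : P) (F : Finset P) (𝓑 : Set (Finset P)),
    Fintype.card P = n ∧ F.card = s ∧ IsLinearSpace o F 3 𝓑

/-- A Steiner quasigroup gives a Steiner triple system. -/
theorem existsTripleSpace_of_op {P : Type} [Fintype P] [Nontrivial P] (m : P → P → P)
    (hcomm : ∀ x y, m x y = m y x)
    (hm : ∀ x y, x ≠ y → m x y ≠ x ∧ m x (m x y) = y) :
    ExistsTripleSpace (Fintype.card P) 3 := by
  classical
  obtain ⟨x, y, hxy⟩ := exists_pair_ne P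
  obtain ⟨h₁, h₂⟩ := hm x y hxy
  obtain ⟨h₃, h₄⟩ := hm y x hxy.symm
  have h₅ := hcomm x (m x y)
  have h₆ := hcomm y (m x y)
  have h₇ := hcomm y x
  rw [h₇] at h₃ h₄
  rw [h₂] at h₅
  rw [h₄] at h₆
  have hFcard : ({x, y, m x y} : Finset P).card = 3 :=
    Finset.card_eq_three.2 ⟨x, y, m x y, hxy, h₁.symm, h₃.symm, rfl⟩
  -- The triple chosen as F is closed under the operation, so a triple meeting F in two points stays
  -- inside F.
  have hcl : ∀ p ∈ ({x, y, m x y} : Finset P), ∀ q ∈ ({x, y, m x y} : Finset P), p ≠ q →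
      m p q ∈ ({x, y, m x y} : Finset P) := by
    intro p hp q hq hpq
    generalize hz : m x y = z at *
    simp only [Finset.mem_insert, Finset.mem_singleton] at hp hq ⊢
    rcases hp with hp | hp | hp <;> rcases hq with hq | hq | hq <;> rw [hp, hq] at hpq ⊢ <;>
      first
      | exact absurd rfl hpq
      | tauto
  refine ⟨P, inferInstance, x, {x, y, m x y}, _, rfl, hFcard,
    .of_op (by simp) m hcomm fun p q hpq hF => ?_⟩
  obtain ⟨h₇, h₈⟩ := hm p q hpq
  refine ⟨h₇, fun h => hF ⟨h.1, ?_⟩, h₈⟩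
  rw [← h₈]
  exact hcl p h.1 _ h.2 h₇.symm

/-! ### Triple systems by the Bose and Skolem constructions -/

namespace TripleSpace

variable {E R : Type} [AddCommGroup R]

/-- The pairs of points that are not covered by the triples `(x, i), (y, i), (z, i + 1)` with
`x ≠ y` and `k i z = x + y`. -/
def Special (k : Fin 3 → R ≃ R) : E ⊕ (R × Fin 3) → E ⊕ (R × Fin 3) → Prop
  | .inr p, .inr q =>
    (q.2 = p.2 + 1 ∧ k p.2 q.1 = p.1 + p.1) ∨ (p.2 = q.2 + 1 ∧ k q.2 p.1 = q.1 + q.1)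
  | _, _ => True

/-- The third point of the triple `(x, i), (y, i), (z, i + 1)` with `k i z = x + y`. -/
def third (k : Fin 3 → R ≃ R) : E ⊕ (R × Fin 3) → E ⊕ (R × Fin 3) → E ⊕ (R × Fin 3)
  | .inr p, .inr q =>
    if q.2 = p.2 + 1 then .inr (k p.2 q.1 - p.1, p.2)
    else if p.2 = q.2 + 1 then .inr (k q.2 p.1 - q.1, q.2)
    else .inr ((k p.2).symm (p.1 + q.1), p.2 + 1)
  | p, _ => p

theorem fin_three_cases (i j : Fin 3) : j = i ∨ j = i + 1 ∨ i = j + 1 := by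
  revert i j; decide

theorem fin_three_ne (i : Fin 3) : i ≠ i + 1 := by revert i; decide

theorem fin_three_ne' (i : Fin 3) : i ≠ i + 1 + 1 := by revert i; decide

theorem special_comm (k : Fin 3 → R ≃ R) (p q : E ⊕ (R × Fin 3)) :
    Special k p q ↔ Special k q p := by
  rcases p with p | p <;> rcases q with q | q <;> simp only [Special, or_comm]

theorem third_comm (k : Fin 3 → R ≃ R) {p q : E ⊕ (R × Fin 3)} (h : ¬Special k p q) :
    third k p q = third k q p := by
  rcases p with p | ⟨x, i⟩ <;> rcases q with q | ⟨y, j⟩ <;> try exact absurd trivial h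
  have h₁ := fin_three_ne
  have h₂ := fin_three_ne'
  rcases fin_three_cases i j with rfl | rfl | rfl <;> simp [third, h₁, h₂, add_comm x y]

theorem third_spec (k : Fin 3 → R ≃ R) {p q : E ⊕ (R × Fin 3)} (hpq : p ≠ q)
    (h : ¬Special k p q) :
    third k p q ≠ p ∧ ¬Special k p (third k p q) ∧ third k p (third k p q) = q := by
  rcases p with p | ⟨x, i⟩ <;> rcases q with q | ⟨y, j⟩ <;> try exact absurd trivial h
  have h₁ := fin_three_ne
  have h₁' := fun i => (h₁ i).symm
  have h₂ := fin_three_ne'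
  rcases fin_three_cases i j with rfl | rfl | rfl
  · have hxy : y ≠ x := fun h => hpq (by rw [h])
    simp [third, Special, h₁, h₁', h₂, hxy]
  · have hxy : k i y ≠ x + x := fun h' => h (Or.inl ⟨rfl, h'⟩)
    simp [third, Special, h₁, hxy, sub_eq_iff_eq_add]
  · have hxy : k j x ≠ y + y := fun h' => h (Or.inr ⟨rfl, h'⟩)
    have : k j x ≠ k j x - y + (k j x - y) := by
      intro h'
      apply hxy
      rw [← sub_eq_zero] at h' ⊢
      rw [← neg_eq_zero, ← h']
      abel
    simp [third, Special, h₁, h₂, this]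

open Classical in
/-- An operation on the special pairs extends to all pairs. -/
theorem exists_op (k : Fin 3 → R ≃ R) (F : Finset (E ⊕ (R × Fin 3)))
    (sp : E ⊕ (R × Fin 3) → E ⊕ (R × Fin 3) → E ⊕ (R × Fin 3))
    (hcomm : ∀ p q, sp p q = sp q p)
    (hF : ∀ p ∈ F, ∀ q ∈ F, p ≠ q → Special k p q)
    (hsp : ∀ p q, Special k p q → p ≠ q → ¬(p ∈ F ∧ q ∈ F) →
      sp p q ≠ p ∧ Special k p (sp p q) ∧ ¬(p ∈ F ∧ sp p q ∈ F) ∧ sp p (sp p q) = q) :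
    ∃ m : E ⊕ (R × Fin 3) → E ⊕ (R × Fin 3) → E ⊕ (R × Fin 3), (∀ p q, m p q = m q p) ∧
      ∀ p q, p ≠ q → ¬(p ∈ F ∧ q ∈ F) →
        m p q ≠ p ∧ ¬(p ∈ F ∧ m p q ∈ F) ∧ m p (m p q) = q := by
  -- Both partial operations preserve their own class of pairs: completing a special pair yields
  -- only special pairs, and likewise for nonspecial ones. Hence they glue. All pairs in F are
  -- special, so a nonspecial triple never has two points in F.
  refine ⟨fun p q => if Special k p q then sp p q else third k p q, ?_, ?_⟩
  · intro p q
    by_cases h : Special k p q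
    · simp only [h, (special_comm k p q).1 h, if_true, hcomm p q]
    · simp only [h, mt (special_comm k p q).2 h, if_false, third_comm k h]
  · intro p q hpq hpF
    by_cases h : Special k p q
    · obtain ⟨h₁, h₂, h₃, h₄⟩ := hsp p q h hpq hpF
      simp only [h, h₂, if_true]
      exact ⟨h₁, h₃, h₄⟩
    · obtain ⟨h₁, h₂, h₃⟩ := third_spec k hpq h
      simp only [h, h₂, if_false]
      exact ⟨h₁, fun h' => h₂ (hF _ h'.1 _ h'.2 h₁.symm), h₃⟩

/-- Doubling is invertible modulo an odd number. With this k, the solution z of k z = x + y is the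
mean of x and y, an idempotent commutative quasigroup. -/
theorem exists_halving (n : ℕ) : ∃ k : ZMod (2 * n + 1) ≃ ZMod (2 * n + 1), ∀ x, k x = x + x := by
  have hinj : Function.Injective fun x : ZMod (2 * n + 1) => x + x := by
    intro x y hxy
    have h : ((2 * n + 1 : ℕ) : ZMod (2 * n + 1)) = 0 := ZMod.natCast_self _
    push_cast at h
    simp only at hxy
    linear_combination (x - y) * h - n * hxy
  exact ⟨Equiv.ofBijective _ (Finite.injective_iff_bijective.1 hinj), fun x => rfl⟩

/-- Bose: the special pairs are the pairs inside a column {x} × `Fin 3`, so the columns are added as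
triples. -/
theorem existsTripleSpace_bose (n : ℕ) : ExistsTripleSpace (6 * n + 3) 3 := by
  obtain ⟨k, hk⟩ := exists_halving n
  have hc : ∀ x y, x + x = y + y ↔ x = y := fun x y => by rw [← hk, ← hk, k.injective.eq_iff]
  -- The three levels sum to 0 modulo 3, so -(i + j) is the third level. Pairs from different
  -- columns are not special, and their value (0, 0) is a default.
  let sp : Empty ⊕ (ZMod (2 * n + 1) × Fin 3) → Empty ⊕ (ZMod (2 * n + 1) × Fin 3) →
      Empty ⊕ (ZMod (2 * n + 1) × Fin 3)
    | .inr p, .inr q => if p.1 = q.1 then .inr (p.1, -(p.2 + q.2)) else .inr (0, 0)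
  obtain ⟨m, hm, hm'⟩ := exists_op (fun _ => k) ∅ sp
    (by
      rintro (p | ⟨x, i⟩) (q | ⟨y, j⟩)
      · exact p.elim
      · exact p.elim
      · exact q.elim
      · by_cases h : x = y
        · subst h; simp [sp, add_comm]
        · simp [sp, h, Ne.symm h])
    (by simp)
    (by
      rintro (p | ⟨x, i⟩) (q | ⟨y, j⟩) h hpq -
      · exact p.elim
      · exact p.elim
      · exact q.elim
      · simp only [Special, hk, hc] at h
        have hxy : x = y := by tauto
        subst hxy
        have hij : i ≠ j := fun h' => hpq (by rw [h'])
        simp only [sp, if_true, Special, hk, and_true, Finset.notMem_empty, false_and,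
          not_false_eq_true, true_and, Sum.inr.injEq, Prod.mk.injEq, ne_eq]
        clear h hpq
        revert i j
        decide)
  have hcard : Fintype.card (Empty ⊕ (ZMod (2 * n + 1) × Fin 3)) = 6 * n + 3 := by
    simp [ZMod.card]; ring
  have : Nontrivial (Empty ⊕ (ZMod (2 * n + 1) × Fin 3)) :=
    ⟨.inr (0, 0), .inr (0, 1), by simp⟩
  rw [← hcard]
  exact existsTripleSpace_of_op m hm fun p q hpq =>
    ⟨(hm' p q hpq (by simp)).1, (hm' p q hpq (by simp)).2.2⟩

/-- Take s = n, L the lower half {0, …, n - 1}, and k x = 2x on L, 2x + 1 elsewhere. Then k maps L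
onto the even and its complement onto the odd residues, and x ↦ k⁻¹(x + x) fixes L and translates
the complement by s. -/
theorem exists_half_idempotent {n : ℕ} (hn : 0 < n) :
    ∃ (k : ZMod (2 * n) ≃ ZMod (2 * n)) (s : ZMod (2 * n)) (L : ZMod (2 * n) → Prop),
      s + s = 0 ∧ (∀ x, L (x + s) ↔ ¬L x) ∧ (∀ x, L x → k x = x + x) ∧
      ∀ x, ¬L x → k (x + s) = x + x := by
  have : NeZero (2 * n) := ⟨by omega⟩
  have hs : (n : ZMod (2 * n)) + n = 0 := by
    rw [← Nat.cast_add, ← two_mul, ZMod.natCast_self]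
  have hL : ∀ x : ZMod (2 * n), (x + n).val < n ↔ ¬x.val < n := by
    intro x
    have hx := x.val_lt
    rw [ZMod.val_add, ZMod.val_cast_of_lt (by omega : n < 2 * n)]
    rcases lt_or_ge x.val n with h | h
    · rw [Nat.mod_eq_of_lt (by omega)]; omega
    · rw [Nat.mod_eq_sub_mod (by omega), Nat.mod_eq_of_lt (by omega)]; omega
  let k : ZMod (2 * n) → ZMod (2 * n) := fun x => x + x + if x.val < n then 0 else 1
  have hval : ∀ x, (k x).val = if x.val < n then 2 * x.val else 2 * (x.val - n) + 1 := by
    intro x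
    have hx := x.val_lt
    by_cases h : x.val < n
    · simp only [k, h, if_true, add_zero]
      rw [ZMod.val_add, Nat.mod_eq_of_lt (by omega)]; omega
    · have : k x = ((2 * x.val + 1 : ℕ) : ZMod (2 * n)) := by
        simp [k, h, two_mul]
      rw [this, ZMod.val_natCast, Nat.mod_eq_sub_mod (by omega), Nat.mod_eq_of_lt (by omega),
        if_neg h]
      omega
  have hinj : Function.Injective k := by
    intro x y hxy
    have h := congrArg ZMod.val hxy
    rw [hval, hval] at h
    apply ZMod.val_injective
    split_ifs at h <;> omega
  refine ⟨Equiv.ofBijective k (Finite.injective_iff_bijective.1 hinj), n, fun x => x.val < n, hs,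
    hL, fun x hx => ?_, fun x hx => ?_⟩
  · simp [k, hx]
  · have h := (hL x).2 hx
    simp only [Equiv.ofBijective_apply, k, h, if_true, add_zero]
    linear_combination hs

-- Skolem: columns over x in L become triples. The remaining special pairs, (x, i) and (x + s, i +
-- 1) with x not in L, match up all points other than the extra one, and each is completed by that
-- point.
open Classical in
theorem existsTripleSpace_skolem {n : ℕ} (hn : 0 < n) : ExistsTripleSpace (6 * n + 1) 3 := by
  obtain ⟨k, s, L, hs, hL, hk, hk'⟩ := exists_half_idempotent hn
  have : NeZero (2 * n) := ⟨by omega⟩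
  have hs' : ∀ x, x + s ≠ x := fun x h => by simpa [h] using hL x
  have hss : ∀ x, x + s + s = x := fun x => by rw [add_assoc, hs, add_zero]
  have hkL : ∀ x y, k y = x + x ↔ (L x ∧ y = x) ∨ (¬L x ∧ y = x + s) := by
    intro x y
    by_cases h : L x
    · simp [h, ← hk x h]
    · simp [h, ← hk' x h]
  -- The partner of a point in this matching; for x in L the partner is one level down, written `+ 1
  -- + 1`.
  let nb : ZMod (2 * n) × Fin 3 → ZMod (2 * n) × Fin 3 :=
    fun p => (p.1 + s, if L p.1 then p.2 + 1 + 1 else p.2 + 1)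
  let sp : Unit ⊕ (ZMod (2 * n) × Fin 3) → Unit ⊕ (ZMod (2 * n) × Fin 3) →
      Unit ⊕ (ZMod (2 * n) × Fin 3)
    | .inr p, .inr q => if p.1 = q.1 then .inr (p.1, -(p.2 + q.2)) else .inl ()
    | .inl _, .inr p => .inr (nb p)
    | .inr p, .inl _ => .inr (nb p)
    | .inl _, .inl _ => .inl ()
  have h₁ : ∀ i : Fin 3, i + 1 + 1 + 1 = i := by decide
  have h₂ := fin_three_ne
  have h₃ : ∀ i : Fin 3, i + 1 + 1 ≠ i := by decide
  obtain ⟨m, hm, hm'⟩ := exists_op (fun _ => k) ∅ sp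
    (by
      rintro (p | ⟨x, i⟩) (q | ⟨y, j⟩) <;> try rfl
      by_cases h : x = y
      · subst h; simp [sp, add_comm]
      · simp [sp, h, Ne.symm h])
    (by simp)
    (by
      rintro (p | ⟨x, i⟩) (q | ⟨y, j⟩) h hpq -
      · exact absurd rfl hpq
      · by_cases hy : L y <;> simp [sp, nb, hy, hL, hss, h₁, Special]
      · by_cases hx : L x <;> simp [sp, nb, hx, hL, hss, h₁, h₃, hkL, Special, (hs' x).symm]
      · simp only [Special, hkL] at h
        rcases h with ⟨rfl, ⟨hL', rfl⟩ | ⟨hL', rfl⟩⟩ | ⟨rfl, ⟨hL', rfl⟩ | ⟨hL', rfl⟩⟩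
        · simp only [sp, Special, hkL]
          simp [hL']
          clear hpq
          revert i
          decide
        · simp [sp, Special, nb, hL', (hs' _).symm]
        · simp only [sp, Special, hkL]
          simp [hL']
          clear hpq
          revert j
          decide
        · simp [sp, Special, nb, hL', hL, hs', hss, h₁])
  have hcard : Fintype.card (Unit ⊕ (ZMod (2 * n) × Fin 3)) = 6 * n + 1 := by
    simp [ZMod.card]; ring
  have : Nontrivial (Unit ⊕ (ZMod (2 * n) × Fin 3)) := ⟨.inl (), .inr (0, 1), by simp⟩
  rw [← hcard]
  exact existsTripleSpace_of_op m hm fun p q hpq =>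
    ⟨(hm' p q hpq (by simp)).1, (hm' p q hpq (by simp)).2.2⟩

/-- The residues up to n contain exactly one of x and -x for each nonzero x. This sign is used to
two-colour the hexagons in `existsTripleSpace_five`. -/
theorem exists_sign (n : ℕ) :
    ∃ σ : ZMod (2 * n + 1) → Bool, ∀ x, x ≠ 0 → σ (-x) = !σ x := by
  refine ⟨fun x => decide (x.val ≤ n), fun x hx => ?_⟩
  have : NeZero x := ⟨hx⟩
  have h := x.val_lt
  change decide ((-x).val ≤ n) = !decide (x.val ≤ n)
  rw [ZMod.val_neg_of_ne_zero, ← decide_not, decide_eq_decide]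
  omega

/-- Twisting the last level by x ↦ -x makes the special pairs between non-extra points form a
hexagon through the six points over x and -x, for each pair ±x ≠ 0, and a triangle for x = 0. The
edges of each hexagon are coloured alternately, and the two colours are completed by the two extra
points. The triangle and the two extra points form the block of size five. -/
theorem existsTripleSpace_five (n : ℕ) : ExistsTripleSpace (6 * n + 5) 5 := by
  obtain ⟨k, hk⟩ := exists_halving n
  obtain ⟨σ, hσ⟩ := exists_sign n
  let g : Fin 3 → ZMod (2 * n + 1) → ZMod (2 * n + 1) := fun i x => if i = 2 then -x else x
  have hgg : ∀ i x, g i (g i x) = x := by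
    intro i x; by_cases h : i = 2 <;> simp [g, h]
  have hg0 : ∀ i x, g i x = 0 ↔ x = 0 := by
    intro i x; by_cases h : i = 2 <;> simp [g, h]
  -- The colour of the special edge from (x, i) to (g i x, i + 1); by `he` it alternates along the
  -- hexagon, including across the sign change.
  let e : ZMod (2 * n + 1) → Fin 3 → Bool := fun x i => xor (σ x) (decide (i = 1))
  have he : ∀ i x, x ≠ 0 → e (g i x) (i + 1) = !e x i := by
    intro i x hx
    fin_cases i <;> simp [e, g, hσ x hx]
  let K : Fin 3 → ZMod (2 * n + 1) ≃ ZMod (2 * n + 1) := fun i => Equiv.trans ⟨g i, g i, hgg i, hgg i⟩ k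
  have hK : ∀ i x y, K i y = x + x ↔ y = g i x := by
    intro i x y
    rw [← hk x]
    simp only [K, Equiv.trans_apply, Equiv.coe_fn_mk, k.injective.eq_iff]
    constructor
    · rintro rfl; rw [hgg]
    · rintro rfl; rw [hgg]
  -- The neighbour of a point along its edge of colour c: the successor if the outgoing edge has
  -- that colour, otherwise the predecessor.
  let nb : Bool → ZMod (2 * n + 1) × Fin 3 → ZMod (2 * n + 1) × Fin 3 := fun c p =>
    if e p.1 p.2 = c then (g p.2 p.1, p.2 + 1) else (g (p.2 + 1 + 1) p.1, p.2 + 1 + 1)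
  let sp : Bool ⊕ (ZMod (2 * n + 1) × Fin 3) → Bool ⊕ (ZMod (2 * n + 1) × Fin 3) → Bool ⊕ (ZMod (2 * n + 1) × Fin 3)
    | .inr p, .inr q => .inl (if q.2 = p.2 + 1 then e p.1 p.2
        else if p.2 = q.2 + 1 then e q.1 q.2 else false)
    | .inl c, .inr p => .inr (nb c p)
    | .inr p, .inl c => .inr (nb c p)
    | .inl _, .inl _ => .inl false
  let F : Finset (Bool ⊕ (ZMod (2 * n + 1) × Fin 3)) :=
    {.inl false, .inl true, .inr (0, 0), .inr (0, 1), .inr (0, 2)}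
  have hFl : ∀ c, .inl c ∈ F := by intro c; cases c <;> simp [F]
  have hFr : ∀ p, .inr p ∈ F ↔ p.1 = 0 := by
    rintro ⟨x, i⟩
    fin_cases i <;> simp [F]
  have h₁ : ∀ i : Fin 3, i + 1 + 1 + 1 = i := by decide
  have h₂ := fin_three_ne
  have h₂' := fun i => (fin_three_ne i).symm
  have h₃ := fin_three_ne'
  have hprev : ∀ i x, x ≠ 0 → e (g (i + 1 + 1) x) (i + 1 + 1) = !e x i := by
    intro i x hx
    have h := he (i + 1 + 1) (g (i + 1 + 1) x) (by rwa [Ne, hg0])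
    rw [hgg, h₁] at h
    rw [h, Bool.not_not]
  obtain ⟨m, hm, hm'⟩ := exists_op K F sp
    (by
      rintro (p | ⟨x, i⟩) (q | ⟨y, j⟩) <;> try rfl
      rcases fin_three_cases i j with rfl | rfl | rfl <;> simp [sp, h₂, h₃])
    (by
      rintro (p | ⟨x, i⟩) hp (q | ⟨y, j⟩) hq hpq <;> try trivial
      obtain rfl : x = 0 := (hFr _).1 hp
      obtain rfl : y = 0 := (hFr _).1 hq
      have hg : ∀ i, g i 0 = 0 := fun i => (hg0 i 0).2 rfl
      rcases fin_three_cases i j with rfl | rfl | rfl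
      · exact absurd rfl hpq
      · exact Or.inl ⟨rfl, (hK _ _ _).2 (hg _).symm⟩
      · exact Or.inr ⟨rfl, (hK _ _ _).2 (hg _).symm⟩)
    (by
      rintro (c | ⟨x, i⟩) (d | ⟨y, j⟩) h hpq hpF
      · exact absurd ⟨hFl _, hFl _⟩ hpF
      · have hy : y ≠ 0 := by simpa [hFl, hFr] using hpF
        by_cases hc : e y j = c
        · have : ¬(!c) = c := by simp
          simp [sp, nb, hc, Special, hFr, hg0, hy, he, h₁, hgg, this]
        · have : (!e y j) = c := by revert hc; cases e y j <;> cases c <;> simp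
          simp [sp, nb, hc, Special, hFr, hg0, hy, hprev, h₁, hgg, this]
      · have hx : x ≠ 0 := by simpa [hFl, hFr] using hpF
        by_cases hc : e x i = d
        · simp [sp, nb, hc, Special, hFr, hx, h₂', hK]
        · have : (!e x i) = d := by revert hc; cases e x i <;> cases d <;> simp
          simp [sp, nb, hc, Special, hFr, hx, hprev, h₁, h₂', (h₃ i).symm, hK, hgg, this]
      · simp only [Special, hK] at h
        rcases h with ⟨rfl, rfl⟩ | ⟨rfl, rfl⟩
        · have hx : x ≠ 0 := by simpa [hFr, hg0] using hpF
          simp [sp, nb, Special, hFr, hx]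
        · have hy : y ≠ 0 := by simpa [hFr, hg0] using hpF
          simp [sp, nb, Special, hFr, hg0, hy, he, h₁, h₃, hgg])
  refine ⟨_, inferInstance, .inl false, F, _, ?_, ?_, .of_op (hFl _) m hm hm'⟩
  · simp [ZMod.card]; ring
  · simp [F]

/-- An order 5 modulo 6 admits no Steiner triple system, hence the alternative of one block of size
five. -/
theorem existsTripleSpace {k : ℕ} (hk : 0 < k) :
    ExistsTripleSpace (2 * k + 1) 3 ∨ ExistsTripleSpace (2 * k + 1) 5 := by
  obtain ⟨n, rfl | rfl | rfl⟩ : ∃ n, k = 3 * n + 1 ∨ k = 3 * n + 2 ∨ k = 3 * n :=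
    ⟨k / 3, by omega⟩
  · left
    convert existsTripleSpace_bose n using 1; ring
  · right
    convert existsTripleSpace_five n using 1; ring
  · left
    convert existsTripleSpace_skolem (by omega : 0 < n) using 1; ring

end TripleSpace

/-! ### Counting: necessary conditions and the exceptions -/

theorem IsCopyEdgeSet.ncard_cycleGraph {V : Type*} {n : ℕ} {G : SimpleGraph V}
    {B : Set (Sym2 V)} (h : IsCopyEdgeSet (SimpleGraph.cycleGraph (n + 3)) G B) :
    B.ncard = n + 3 := by
  obtain ⟨f, hf, -, rfl⟩ := isCopyEdgeSet_iff.1 h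
  rw [Set.ncard_image_of_injective _ (Sym2.map.injective hf), ← SimpleGraph.coe_edgeFinset,
    Set.ncard_coe_finset]
  have := (SimpleGraph.cycleGraph (n + 3)).sum_degrees_eq_twice_card_edges
  simp only [SimpleGraph.cycleGraph_degree_three_le, Finset.sum_const, Finset.card_univ,
    Fintype.card_fin, smul_eq_mul] at this
  omega

/-- A cycle has an even number of edges at each vertex. -/
theorem IsCopyEdgeSet.even_ncard_cycleGraph {V : Type*} {n : ℕ} {G : SimpleGraph V}
    {B : Set (Sym2 V)} (h : IsCopyEdgeSet (SimpleGraph.cycleGraph (n + 3)) G B) (x : V) :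
    Even (B ∩ {e | x ∈ e}).ncard := by
  obtain ⟨f, hf, -, rfl⟩ := isCopyEdgeSet_iff.1 h
  by_cases hx : ∃ i, f i = x
  · obtain ⟨i, rfl⟩ := hx
    have : Sym2.map f '' (SimpleGraph.cycleGraph (n + 3)).edgeSet ∩ {e | f i ∈ e} =
        Sym2.map f '' ((SimpleGraph.cycleGraph (n + 3)).incidenceFinset i : Set _) := by
      ext e
      simp only [SimpleGraph.coe_incidenceFinset, SimpleGraph.incidenceSet, Set.mem_inter_iff,
        Set.mem_image, Set.mem_ofPred_eq]
      constructor
      · rintro ⟨⟨e, he, rfl⟩, hi⟩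
        obtain ⟨j, hj, hji⟩ := Sym2.mem_map.1 hi
        exact ⟨e, ⟨he, hf hji ▸ hj⟩, rfl⟩
      · rintro ⟨e, ⟨he, hi⟩, rfl⟩
        exact ⟨⟨e, he, rfl⟩, Sym2.mem_map.2 ⟨i, hi, rfl⟩⟩
    rw [this, Set.ncard_image_of_injective _ (Sym2.map.injective hf), Set.ncard_coe_finset,
      SimpleGraph.card_incidenceFinset_eq_degree, SimpleGraph.cycleGraph_degree_three_le]
    exact even_two
  · suffices h : Sym2.map f '' (SimpleGraph.cycleGraph (n + 3)).edgeSet ∩ {e | x ∈ e} = ∅ by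
      rw [h, Set.ncard_empty]; exact Even.zero
    ext e
    simp only [Set.mem_inter_iff, Set.mem_image, Set.mem_ofPred_eq, Set.mem_empty_iff_false,
      iff_false]
    rintro ⟨⟨e, -, rfl⟩, hxe⟩
    obtain ⟨j, -, hj⟩ := Sym2.mem_map.1 hxe
    exact hx ⟨j, hj⟩

/-- The edges of a set are counted block by block. -/
theorem IsGraphDecomposition.ncard_inter {W V : Type*} [Finite V] {H : SimpleGraph W}
    {G : SimpleGraph V} {C : Set (Set (Sym2 V))} (h : IsGraphDecomposition H G C)
    (T : Set (Sym2 V)) :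
    (G.edgeSet ∩ T).ncard = ∑ B ∈ (Set.toFinite C).toFinset, (B ∩ T).ncard := by
  classical
  have hfin : ∀ s : Set (Sym2 V), s.Finite := fun s => Set.toFinite s
  have : G.edgeSet ∩ T =
      ↑((Set.toFinite C).toFinset.biUnion fun B => (hfin (B ∩ T)).toFinset) := by
    ext e
    simp only [Set.mem_inter_iff, Finset.coe_biUnion, Set.Finite.coe_toFinset, Set.mem_iUnion,
      exists_prop]
    constructor
    · rintro ⟨he, hT⟩
      obtain ⟨B, ⟨hB, heB⟩, -⟩ := h.cover e he
      exact ⟨B, hB, heB, hT⟩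
    · rintro ⟨B, hB, heB, hT⟩
      exact ⟨(h.copy B hB).subset heB, hT⟩
  rw [this, Set.ncard_coe_finset, Finset.card_biUnion]
  · exact Finset.sum_congr rfl fun B _ => (Set.ncard_eq_toFinset_card _ _).symm
  · intro B hB B' hB' hne
    rw [Finset.mem_coe, Set.Finite.mem_toFinset] at hB hB'
    rw [Function.onFun, Finset.disjoint_left]
    intro e he he'
    rw [Set.Finite.mem_toFinset] at he he'
    exact hne ((h.cover e ((h.copy B hB).subset he.1)).unique ⟨hB, he.1⟩ ⟨hB', he'.1⟩)

theorem IsCycleSystem.card_mul {n v : ℕ} {C : Set (Set (Sym2 (Fin v)))}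
    (h : IsCycleSystem (n + 3) v C) : C.ncard * (n + 3) = v * (v - 1) / 2 := by
  have h₁ := IsGraphDecomposition.ncard_inter h Set.univ
  simp only [Set.inter_univ] at h₁
  rw [Finset.sum_congr rfl fun B hB =>
    (h.copy B ((Set.Finite.mem_toFinset _).1 hB)).ncard_cycleGraph, Finset.sum_const,
    smul_eq_mul, ← Set.ncard_eq_toFinset_card] at h₁
  rw [← h₁, SimpleGraph.completeGraph, ← SimpleGraph.coe_edgeFinset, Set.ncard_coe_finset,
    SimpleGraph.card_edgeFinset_top_eq_card_choose_two, Fintype.card_fin, Nat.choose_two_right]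

/-- The v - 1 edges at a vertex are distributed among blocks, each of which contains an even number
of them. -/
theorem IsCycleSystem.odd {n v : ℕ} {C : Set (Set (Sym2 (Fin v)))}
    (h : IsCycleSystem (n + 3) v C) (hv : 0 < v) : Even (v - 1) := by
  let x : Fin v := ⟨0, hv⟩
  have h₁ := IsGraphDecomposition.ncard_inter h {e | x ∈ e}
  have h₂ : ((SimpleGraph.completeGraph (Fin v)).edgeSet ∩ {e | x ∈ e}).ncard = v - 1 := by
    have : (SimpleGraph.completeGraph (Fin v)).edgeSet ∩ {e | x ∈ e} =
        ((⊤ : SimpleGraph (Fin v)).incidenceFinset x : Set _) := by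
      rw [SimpleGraph.coe_incidenceFinset]; rfl
    rw [this, Set.ncard_coe_finset, SimpleGraph.card_incidenceFinset_eq_degree,
      SimpleGraph.complete_graph_degree, Fintype.card_fin]
  rw [← h₂, h₁]
  exact Finset.even_sum _ fun B hB =>
    (h.copy B ((Set.Finite.mem_toFinset _).1 hB)).even_ncard_cycleGraph x

/-- The edges of a block of one system lie in different blocks of the other. -/
theorem le_ncard_of_areOrthogonal {n v : ℕ} {C₁ C₂ : Set (Set (Sym2 (Fin v)))}
    (h₁ : IsCycleSystem (n + 3) v C₁) (h₂ : IsCycleSystem (n + 3) v C₂)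
    (h : AreOrthogonal C₁ C₂) (hv : 2 ≤ v) : n + 3 ≤ C₂.ncard := by
  have he : s(⟨0, by omega⟩, ⟨1, by omega⟩) ∈ (SimpleGraph.completeGraph (Fin v)).edgeSet := by
    simp [SimpleGraph.completeGraph]
  obtain ⟨B, ⟨hB, -⟩, -⟩ := h₁.cover _ he
  have hBc := h₁.copy B hB
  have hcov : ∀ e : B, ∃ B', B' ∈ C₂ ∧ e.1 ∈ B' :=
    fun e => (h₂.cover e.1 (hBc.subset e.2)).exists
  choose g hg hg' using hcov
  have hinj : Function.Injective fun e : B => (⟨g e, hg e⟩ : C₂) := by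
    intro e e' hee
    have hee' : g e = g e' := congrArg Subtype.val hee
    exact Subtype.ext (Set.encard_le_one_iff.1 (h B hB (g e) (hg e)) e.1 e'.1 ⟨e.2, hg' e⟩
      ⟨e'.2, hee' ▸ hg' e'⟩)
  rw [← hBc.ncard_cycleGraph, ← Nat.card_coe_set_eq, ← Nat.card_coe_set_eq]
  exact Nat.card_le_card_of_injective _ hinj

/-- At least l blocks are needed, but l blocks of l edges exceed the l(l - 1)/2 edges available. -/
theorem not_existsOrthogonalPair_self {l : ℕ} (hl : 3 ≤ l) : ¬ExistsOrthogonalPair l l := by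
  obtain ⟨n, rfl⟩ : ∃ n, l = n + 3 := ⟨l - 3, by omega⟩
  rintro ⟨C₁, C₂, h₁, h₂, h⟩
  have h₃ := le_ncard_of_areOrthogonal h₁ h₂ h (by omega)
  have h₄ := h₂.card_mul
  have h₅ : (n + 3) * (n + 3) ≤ (n + 3) * (n + 3 - 1) / 2 := by
    rw [← h₄]; exact Nat.mul_le_mul_right _ h₃
  have h₆ := Nat.div_mul_le_self ((n + 3) * (n + 3 - 1)) 2
  have h₇ : (n + 3) * (n + 3 - 1) ≤ (n + 3) * (n + 3) := Nat.mul_le_mul_left _ (by omega)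
  nlinarith

/-- The necessary conditions for the existence of an `l`-cycle system of order `v`. -/
theorem IsCycleSystem.admissible {l v : ℕ} {C : Set (Set (Sym2 (Fin v)))}
    (h : IsCycleSystem l v C) (hl : 3 ≤ l) (hv : 0 < v) :
    ∃ k, v = 2 * k + 1 ∧ l ∣ (2 * k + 1) * k := by
  obtain ⟨n, rfl⟩ : ∃ n, l = n + 3 := ⟨l - 3, by omega⟩
  obtain ⟨k, hk⟩ := h.odd hv
  refine ⟨k, by omega, C.ncard, ?_⟩
  have h₁ := h.card_mul
  obtain rfl : v = 2 * k + 1 := by omega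
  have h₂ : (2 * k + 1) * (2 * k + 1 - 1) = (2 * k + 1) * k * 2 := by
    rw [Nat.add_sub_cancel]; ring
  rw [mul_comm (n + 3), h₁, h₂, Nat.mul_div_cancel _ two_pos]

/-- Reduces the divisibility condition to a finite check over the residues of k modulo l. -/
theorem mod_cases_of_dvd {l k : ℕ} (h : l ∣ (2 * k + 1) * k) :
    (2 * (k % l) + 1) * (k % l) % l = 0 := by
  have : (2 * (k % l) + 1) * (k % l) ≡ (2 * k + 1) * k [MOD l] :=
    (((Nat.mod_modEq k l).mul_left 2).add_right 1).mul (Nat.mod_modEq k l)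
  rw [this, Nat.mod_eq_zero_of_dvd h]

/-! ### Assembling the orders from the ingredients -/

/-- Blow up a linear space on 2j + 1 points with weight l, and weight c at o. The block F has 3 or 5
points, depending on j, so full pairs of both orders c + 2l and c + 4l are supplied. -/
theorem existsOrthogonalPair_of_triples {l c j v : ℕ} (hj : 0 < j) (hv : v = c + 2 * j * l)
    (h₃ : HasOrthogonalPair (SimpleGraph.cycleGraph l) (holeyGraph 1 (c + 2 * l)))
    (h₅ : HasOrthogonalPair (SimpleGraph.cycleGraph l) (holeyGraph 1 (c + 4 * l)))
    (hhole : HasOrthogonalPair (SimpleGraph.cycleGraph l) (holeyGraph c (c + 2 * l)))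
    (hpart : HasOrthogonalPair (SimpleGraph.cycleGraph l) (residueGraph 3 (l * 3))) :
    ExistsOrthogonalPair l v := by
  rcases TripleSpace.existsTripleSpace hj with
    ⟨P, _, o, F, 𝓑, hP, hF, h⟩ | ⟨P, _, o, F, 𝓑, hP, hF, h⟩
  · exact h.existsOrthogonalPair hF (by rw [hP, hv, Nat.add_sub_cancel]) h₃ hhole hpart
  · exact h.existsOrthogonalPair hF (by rw [hP, hv, Nat.add_sub_cancel]) h₅ hhole hpart

/-- Here F = {o} carries the complete graph on the c copies of o, and the other blocks are all pairs
of points. -/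
theorem existsOrthogonalPair_of_pairs {l c w j v : ℕ} (hv : v = c + j * w)
    (hfull : HasOrthogonalPair (SimpleGraph.cycleGraph l) (holeyGraph 1 c))
    (hhole : HasOrthogonalPair (SimpleGraph.cycleGraph l) (holeyGraph c (c + w)))
    (hpart : HasOrthogonalPair (SimpleGraph.cycleGraph l) (residueGraph 2 (w * 2))) :
    ExistsOrthogonalPair l v :=
  (isLinearSpace_pairs j).existsOrthogonalPair (f := 0) (by simp) (by simpa using hv)
    (by rwa [zero_mul, add_zero]) (by rwa [one_mul]) hpart

theorem hasOrthogonalPair_holeyGraph_self {W : Type*} (H : SimpleGraph W) (n : ℕ) :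
    HasOrthogonalPair H (holeyGraph n n) := by
  have : holeyGraph n n = ⊥ := by
    ext x y
    simp [holeyGraph]
  rw [this]
  exact hasOrthogonalPair_bot H

/-- With j = k / l, the order is 1 + 2jl or l + 2jl according to the residue. For c = 1 the hole is
trivial, so `h₁₃` serves both as the full and as the holey ingredient. -/
theorem existsOrthogonalPair_of_odd {l k : ℕ} (hk : 0 < k) (hkl : 2 * k + 1 ≠ l)
    (hmod : k % l = 0 ∨ 2 * (k % l) + 1 = l)
    (hpart : HasOrthogonalPair (SimpleGraph.cycleGraph l) (residueGraph 3 (l * 3)))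
    (h₁₃ : HasOrthogonalPair (SimpleGraph.cycleGraph l) (holeyGraph 1 (1 + 2 * l)))
    (h₁₅ : HasOrthogonalPair (SimpleGraph.cycleGraph l) (holeyGraph 1 (1 + 4 * l)))
    (h₃ : HasOrthogonalPair (SimpleGraph.cycleGraph l) (holeyGraph 1 (l + 2 * l)))
    (h₅ : HasOrthogonalPair (SimpleGraph.cycleGraph l) (holeyGraph 1 (l + 4 * l)))
    (hhole : HasOrthogonalPair (SimpleGraph.cycleGraph l) (holeyGraph l (l + 2 * l))) :
    ExistsOrthogonalPair l (2 * k + 1) := by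
  have hdiv := Nat.div_add_mod k l
  -- If k < l, the residue condition leaves only k = 0 and 2k + 1 = l, both excluded.
  rcases Nat.eq_zero_or_pos (k / l) with h₀ | h₀
  · rw [h₀] at hdiv
    rcases hmod with h | h <;> omega
  · rcases hmod with h | h
    · exact existsOrthogonalPair_of_triples h₀ (by rw [h] at hdiv; linarith) h₁₃ h₁₅ h₁₃ hpart
    · exact existsOrthogonalPair_of_triples h₀ (by linarith) h₃ h₅ hhole hpart

theorem mainTheorem1 (l v : ℕ) (hl3 : 3 ≤ l) (hl9 : l ≤ 9) (hlv : l ≤ v)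
    (hadm : ∃ C : Set (Set (Sym2 (Fin v))), IsCycleSystem l v C) :
    ExistsOrthogonalPair l v ↔
      (l, v) ∉ ({(3, 3), (5, 5), (7, 7), (9, 9)} : Set (ℕ × ℕ)) := by
  constructor
  · intro h hmem
    have : v = l := by
      simp only [Set.mem_insert_iff, Set.mem_singleton_iff, Prod.mk.injEq] at hmem
      omega
    subst this
    exact not_existsOrthogonalPair_self hl3 h
  · intro hmem
    obtain ⟨C, hC⟩ := hadm
    obtain ⟨k, rfl, hdvd⟩ := hC.admissible hl3 (by omega)
    have hmod := mod_cases_of_dvd hdvd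
    have hlt : k % l < l := Nat.mod_lt _ (by omega)
    have hk : 0 < k := by omega
    simp only [Set.mem_insert_iff, Set.mem_singleton_iff, Prod.mk.injEq] at hmem
    interval_cases l
    · exact existsOrthogonalPair_of_odd hk (by omega)
        (by generalize k % 3 = r at *; interval_cases r <;> omega)
        hasOrthogonalPair_cycle3_residueGraph_3_9 hasOrthogonalPair_cycle3_holeyGraph_1_7
        hasOrthogonalPair_cycle3_holeyGraph_1_13 hasOrthogonalPair_cycle3_holeyGraph_1_9
        hasOrthogonalPair_cycle3_holeyGraph_1_15 hasOrthogonalPair_cycle3_holeyGraph_3_9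
    -- As 2k + 1 is odd, the power of two l must divide k, so v = 1 + 8j; the same happens for l =
    -- 8.
    · have : k % 4 = 0 := by
        generalize k % 4 = r at *; interval_cases r <;> omega
      exact existsOrthogonalPair_of_pairs (c := 1) (w := 8) (j := k / 4) (by omega)
        (hasOrthogonalPair_holeyGraph_self _ 1) hasOrthogonalPair_cycle4_holeyGraph_1_9
        hasOrthogonalPair_cycle4_residueGraph_2_16
    · exact existsOrthogonalPair_of_odd hk (by omega)
        (by generalize k % 5 = r at *; interval_cases r <;> omega)
        hasOrthogonalPair_cycle5_residueGraph_3_15 hasOrthogonalPair_cycle5_holeyGraph_1_11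
        hasOrthogonalPair_cycle5_holeyGraph_1_21 hasOrthogonalPair_cycle5_holeyGraph_1_15
        hasOrthogonalPair_cycle5_holeyGraph_1_25 hasOrthogonalPair_cycle5_holeyGraph_5_15
    -- k is even, and 3 divides k or 2k + 1. These classes give v = 1 + 12j and v = 9 + 12j.
    · have : k % 6 = 0 ∨ k % 6 = 4 := by
        generalize k % 6 = r at *; interval_cases r <;> omega
      rcases this with h | h
      · exact existsOrthogonalPair_of_pairs (c := 1) (w := 12) (j := k / 6) (by omega)
          (hasOrthogonalPair_holeyGraph_self _ 1) hasOrthogonalPair_cycle6_holeyGraph_1_13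
          hasOrthogonalPair_cycle6_residueGraph_2_24
      · exact existsOrthogonalPair_of_pairs (c := 9) (w := 12) (j := k / 6) (by omega)
          hasOrthogonalPair_cycle6_holeyGraph_1_9 hasOrthogonalPair_cycle6_holeyGraph_9_21
          hasOrthogonalPair_cycle6_residueGraph_2_24
    · exact existsOrthogonalPair_of_odd hk (by omega)
        (by generalize k % 7 = r at *; interval_cases r <;> omega)
        hasOrthogonalPair_cycle7_residueGraph_3_21 hasOrthogonalPair_cycle7_holeyGraph_1_15
        hasOrthogonalPair_cycle7_holeyGraph_1_29 hasOrthogonalPair_cycle7_holeyGraph_1_21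
        hasOrthogonalPair_cycle7_holeyGraph_1_35 hasOrthogonalPair_cycle7_holeyGraph_7_21
    · have : k % 8 = 0 := by
        generalize k % 8 = r at *; interval_cases r <;> omega
      exact existsOrthogonalPair_of_pairs (c := 1) (w := 16) (j := k / 8) (by omega)
        (hasOrthogonalPair_holeyGraph_self _ 1) hasOrthogonalPair_cycle8_holeyGraph_1_17
        hasOrthogonalPair_cycle8_residueGraph_2_32
    · exact existsOrthogonalPair_of_odd hk (by omega)
        (by generalize k % 9 = r at *; interval_cases r <;> omega)
        hasOrthogonalPair_cycle9_residueGraph_3_27 hasOrthogonalPair_cycle9_holeyGraph_1_19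
        hasOrthogonalPair_cycle9_holeyGraph_1_37 hasOrthogonalPair_cycle9_holeyGraph_1_27
        hasOrthogonalPair_cycle9_holeyGraph_1_45 hasOrthogonalPair_cycle9_holeyGraph_9_27
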